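/- Let $M_0$ be a free abelian group with basis $b_0,b_1,b_2,\dots$, and put $b_k=0$ for $k<0$. For $s\ge 0$ let $\mathcal G_s\subseteq\bigwedge^sM_0$ be the Grassmann cone, i.e. the set of all $m_1\wedge\cdots\wedge m_s$ with $m_i\in M_0$. Let $\sigma_-(z),\overline\sigma_-(z):\bigwedge M_0\to(\bigwedge M_0)[z^{-1}]$ be the unique algebra homomorphisms with $\sigma_-(z)b_i=\sum_{j\ge0}b_{i-j}z^{-j}$ and $\overline\sigma_-(z)b_i=b_i-b_{i-1}z^{-1}$; they are inverse to each other when extended $z^{-1}$-linearly. Let $B_s=\mathbb Z[e_1,\dots,e_s]$, $B_\infty=\mathbb Z[e_1,e_2,\dots]$, $E_s(z)=1-e_1z+\cdots+(-1)^se_sz^s$, $E_\infty(z)=1+\sum_{i\ge1}(-1)^ie_iz^i$. For $s\in\mathbb N\cup\{\infty\}$ let $h_n\in B_s$ be the coefficients of $E_s(z)^{-1}=\sum_{n\ge0}h_nz^n$, with $h_n=0$ for $n<0$. For a partition $\lambda=(\lambda_1\ge\lambda_2\ge\cdots)$ of length $\ell(\lambda)\le s$ let $\Delta_\lambda(H_s)=\det(h_{\lambda_j-j+i})_{1\le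 i,j\le s}\in B_s$ and $[\mathbf b]^s_\lambda=b_{\lambda_s}\wedge b_{1+\lambda_{s-1}}\wedge\cdots\wedge b_{s-1+\lambda_1}\in\bigwedge^sM_0$; for $s=\infty$ the determinant has size $\ell(\lambda)$. The $\Delta_\lambda(H_s)$ with $\ell(\lambda)\le s$ form a $\mathbb Z$-basis of $B_s$ (all $\lambda$ if $s=\infty$), and for finite $s$ the $[\mathbf b]^s_\lambda$ form a $\mathbb Z$-basis of $\bigwedge^sM_0$. Let $\phi_s:B_s\to\bigwedge^sM_0$ be the isomorphism of abelian groups with $\phi_s(\Delta_\lambda(H_s))=[\mathbf b]^s_\lambda$. Let $\sigma_-(z),\overline\sigma_-(z)$ also denote the additive maps $B_\infty\to B_\infty[z^{-1}]$ that send $\Delta_\lambda(H_\infty)$ to $\sum_\mu a_\mu(z^{-1})\Delta_\mu(H_\infty)$, where $\sum_\mu a_\mu(z^{-1})[\mathbf b]^s_\mu$ is $\sigma_-(z)[\mathbf b]^s_\lambda$, respectively $\overline\sigma_-(z)[\mathbf b]^s_\lambda$; this does not depend on the choice of $s\ge\ell(\lambda)$. We say that $p\in B_\infty$ corresponds to an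 element of the Grassmann cone $\mathcal G_\infty$ if, for all sufficiently large $s$, $p\in B_s$ and $\phi_s(p)\in\mathcal G_s$. For $f=\sum_i f_iz^i$ and $g=\sum_j g_jz^j$ in $B_\infty((z))$ write $f\otimes g=\sum_n\big(\sum_{i+j=n}f_i\otimes g_j\big)z^n\in(B_\infty\otimes_{\mathbb Z}B_\infty)((z))$, and let $\mathrm{Res}_z$ denote the coefficient of $z^{-1}$. Then $p\in B_\infty$ corresponds to an element of $\mathcal G_\infty$ if and only if $$\mathrm{Res}_z\Big(E_\infty(z)\,\sigma_-(z)p\;\otimes_{\mathbb Z}\;\frac1{E_\infty(z)}\,\overline\sigma_-(z)p\Big)=0 .$$ -/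

import Mathlib

open scoped TensorProduct

noncomputable section

namespace GrassmannKP

/-! ### The free abelian group `M₀`, its exterior algebra, and Schubert derivations -/

/-- The free abelian group of countable rank. -/
abbrev M₀ : Type := ℕ →₀ ℤ

/-- The basis `b₀, b₁, …` of `M₀`. -/
def b (i : ℕ) : M₀ := Finsupp.single i 1

/-- The exterior algebra `⋀ M₀`. -/
abbrev Ext : Type := ExteriorAlgebra ℤ M₀

/-- The inclusion `M₀[w] → (⋀ M₀)[w]`; an element of `M₀[w]` is the finitely supported family of
its coefficients. -/
def toExtPoly : (ℕ →₀ M₀) →ₗ[ℤ] Polynomial Ext :=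
  Finsupp.lsum ℤ fun j =>
    ((Polynomial.monomial j : Ext →ₗ[Ext] Polynomial Ext).restrictScalars ℤ).comp
      (ExteriorAlgebra.ι ℤ)

theorem toExtPoly_single (j : ℕ) (m : M₀) :
    toExtPoly (Finsupp.single j m) = Polynomial.monomial j (ExteriorAlgebra.ι ℤ m) := by
  simp [toExtPoly]

theorem toExtPoly_anticomm (x y : ℕ →₀ M₀) :
    toExtPoly x * toExtPoly y + toExtPoly y * toExtPoly x = 0 := by
  induction x using Finsupp.induction_linear with
  | zero => simp
  | add x₁ x₂ h₁ h₂ =>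
    calc _ = (toExtPoly x₁ * toExtPoly y + toExtPoly y * toExtPoly x₁)
          + (toExtPoly x₂ * toExtPoly y + toExtPoly y * toExtPoly x₂) := by
            rw [map_add]; noncomm_ring
      _ = 0 := by rw [h₁, h₂, add_zero]
  | single i m =>
    induction y using Finsupp.induction_linear with
    | zero => simp
    | add y₁ y₂ h₁ h₂ =>
      rw [map_add, mul_add, add_mul, add_add_add_comm, h₁, h₂, add_zero]
    | single j n =>
      rw [toExtPoly_single, toExtPoly_single, Polynomial.monomial_mul_monomial,
        Polynomial.monomial_mul_monomial, add_comm j i, ← map_add,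
        ExteriorAlgebra.ι_add_mul_swap, map_zero]

theorem toExtPoly_mul_self (x : ℕ →₀ M₀) : toExtPoly x * toExtPoly x = 0 := by
  induction x using Finsupp.induction_linear with
  | zero => simp
  | add x₁ x₂ h₁ h₂ =>
    rw [map_add, mul_add, add_mul, add_mul, h₁, h₂, zero_add, add_zero, add_comm]
    exact toExtPoly_anticomm x₁ x₂
  | single i m =>
    rw [toExtPoly_single, Polynomial.monomial_mul_monomial, ExteriorAlgebra.ι_sq_zero, map_zero]

/-- The unique Hasse–Schmidt derivation (algebra homomorphism) `⋀ M₀ → (⋀ M₀)[w]` that extends a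
given `ℤ`-linear map `M₀ → M₀[w]`. -/
def hasseSchmidt (f : M₀ →ₗ[ℤ] (ℕ →₀ M₀)) : Ext →ₐ[ℤ] Polynomial Ext :=
  ExteriorAlgebra.lift ℤ ⟨toExtPoly ∘ₗ f, fun m => toExtPoly_mul_self (f m)⟩

/-- The map `bᵢ ↦ ∑_{j ≤ i} b_{i-j} wʲ` from `M₀` to `M₀[w]`. -/
def shiftMinus : M₀ →ₗ[ℤ] (ℕ →₀ M₀) :=
  Finsupp.linearCombination ℤ fun i =>
    ∑ j ∈ Finset.range (i + 1), Finsupp.single j (b (i - j))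

/-- The map `bᵢ ↦ bᵢ - b_{i-1} w` from `M₀` to `M₀[w]`, where `b₋₁ = 0`. -/
def shiftBarMinus : M₀ →ₗ[ℤ] (ℕ →₀ M₀) :=
  Finsupp.linearCombination ℤ fun i =>
    Finsupp.single 0 (b i) - (if i = 0 then 0 else Finsupp.single 1 (b (i - 1)))

/-- The Schubert derivation `σ₋(z)`, in the variable `w = z⁻¹`: the Hasse–Schmidt derivation with
`σ₋(z) bᵢ = ∑_{j ≤ i} b_{i-j} z⁻ʲ`. -/
def sigmaMinus : Ext →ₐ[ℤ] Polynomial Ext := hasseSchmidt shiftMinus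

/-- The Schubert derivation `σ̄₋(z)`, in the variable `w = z⁻¹`: the Hasse–Schmidt derivation with
`σ̄₋(z) bᵢ = bᵢ - b_{i-1} z⁻¹`. It is the inverse of `σ₋(z)`: see
`sigmaBarMinus_sigmaMinus` and `sigmaMinus_sigmaBarMinus`. -/
def sigmaBarMinus : Ext →ₐ[ℤ] Polynomial Ext := hasseSchmidt shiftBarMinus

/-- The `w`-linear extension of `D : ⋀ M₀ → (⋀ M₀)[w]` to `(⋀ M₀)[w]`. -/
def extendW (D : Ext →ₐ[ℤ] Polynomial Ext) : Polynomial Ext →+* Polynomial Ext :=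
  Polynomial.eval₂RingHom' (D : Ext →+* Polynomial Ext) Polynomial.X
    fun _ => (Polynomial.commute_X _).symm

theorem extendW_C (D : Ext →ₐ[ℤ] Polynomial Ext) (x : Ext) :
    extendW D (Polynomial.C x) = D x := by
  simp [extendW, Polynomial.eval₂RingHom']

theorem extendW_X (D : Ext →ₐ[ℤ] Polynomial Ext) : extendW D Polynomial.X = Polynomial.X := by
  simp [extendW, Polynomial.eval₂RingHom']

theorem sigmaMinus_b_zero :
    sigmaMinus (ExteriorAlgebra.ι ℤ (b 0)) = Polynomial.C (ExteriorAlgebra.ι ℤ (b 0)) := by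
  simp [sigmaMinus, hasseSchmidt, shiftMinus, b, toExtPoly_single]

theorem sigmaMinus_b_succ (i : ℕ) :
    sigmaMinus (ExteriorAlgebra.ι ℤ (b (i + 1))) = Polynomial.C (ExteriorAlgebra.ι ℤ (b (i + 1)))
      + Polynomial.X * sigmaMinus (ExteriorAlgebra.ι ℤ (b i)) := by
  simp only [sigmaMinus, hasseSchmidt, shiftMinus, ExteriorAlgebra.lift_ι_apply,
    LinearMap.comp_apply]
  rw [show b (i + 1) = Finsupp.single (i + 1) 1 from rfl, show b i = Finsupp.single i 1 from rfl,
    Finsupp.linearCombination_single, Finsupp.linearCombination_single, one_smul, one_smul,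
    Finset.sum_range_succ', map_add, map_sum, map_sum, Finset.mul_sum, add_comm]
  congr 1
  · simp [toExtPoly_single, b]
  · refine Finset.sum_congr rfl fun j _ => ?_
    rw [toExtPoly_single, toExtPoly_single, Polynomial.X_mul_monomial, Nat.add_sub_add_right]

theorem sigmaBarMinus_b_zero :
    sigmaBarMinus (ExteriorAlgebra.ι ℤ (b 0)) = Polynomial.C (ExteriorAlgebra.ι ℤ (b 0)) := by
  simp [sigmaBarMinus, hasseSchmidt, shiftBarMinus, b, toExtPoly_single]

theorem sigmaBarMinus_b_succ (i : ℕ) :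
    sigmaBarMinus (ExteriorAlgebra.ι ℤ (b (i + 1))) =
      Polynomial.C (ExteriorAlgebra.ι ℤ (b (i + 1)))
        - Polynomial.X * Polynomial.C (ExteriorAlgebra.ι ℤ (b i)) := by
  simp [sigmaBarMinus, hasseSchmidt, shiftBarMinus, b, toExtPoly_single,
    Polynomial.X_mul_C, Polynomial.C_mul_X_eq_monomial]

theorem extendW_comp_eq_C (D D' : Ext →ₐ[ℤ] Polynomial Ext)
    (hD : ∀ i, extendW D (D' (ExteriorAlgebra.ι ℤ (b i)))
      = Polynomial.C (ExteriorAlgebra.ι ℤ (b i))) (x : Ext) :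
    extendW D (D' x) = Polynomial.C x := by
  have key : ((extendW D).toIntAlgHom).comp D' =
      (Polynomial.C : Ext →+* Polynomial Ext).toIntAlgHom := by
    apply ExteriorAlgebra.hom_ext
    apply Finsupp.lhom_ext
    intro i n
    have hn : (Finsupp.single i n : M₀) = n • b i := by simp [b]
    rw [hn, map_smul, map_smul]
    congr 1
    exact hD i
  exact DFunLike.congr_fun key x

theorem sigmaBarMinus_sigmaMinus (x : Ext) :
    extendW sigmaBarMinus (sigmaMinus x) = Polynomial.C x := by
  refine extendW_comp_eq_C _ _ (fun i => ?_) x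
  induction i with
  | zero => rw [sigmaMinus_b_zero, extendW_C, sigmaBarMinus_b_zero]
  | succ i ih =>
    rw [sigmaMinus_b_succ, map_add, map_mul, ih, extendW_C, extendW_X, sigmaBarMinus_b_succ,
      sub_add_cancel]

theorem sigmaMinus_sigmaBarMinus (x : Ext) :
    extendW sigmaMinus (sigmaBarMinus x) = Polynomial.C x := by
  refine extendW_comp_eq_C _ _ (fun i => ?_) x
  cases i with
  | zero => rw [sigmaBarMinus_b_zero, extendW_C, sigmaMinus_b_zero]
  | succ i =>
    rw [sigmaBarMinus_b_succ, map_sub, map_mul, extendW_C, extendW_C, extendW_X,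
      sigmaMinus_b_succ, add_sub_cancel_right]

theorem toExtPoly_coeff (x : ℕ →₀ M₀) (k : ℕ) :
    (toExtPoly x).coeff k = ExteriorAlgebra.ι ℤ (x k) := by
  induction x using Finsupp.induction_linear with
  | zero => simp
  | add x y hx hy => simp [hx, hy]
  | single i m =>
    rw [toExtPoly_single, Polynomial.coeff_monomial, Finsupp.single_apply]
    split_ifs <;> simp

/-- The coefficients of a Hasse–Schmidt derivation that extends a map `M₀ → M₀[w]` preserve each
exterior power. -/
theorem hasseSchmidt_coeff_mem (f : M₀ →ₗ[ℤ] (ℕ →₀ M₀)) (r : ℕ) (x : Ext) (hx : x ∈ ⋀[ℤ]^r M₀)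
    (k : ℕ) : (hasseSchmidt f x).coeff k ∈ ⋀[ℤ]^r M₀ := by
  induction hx using Submodule.pow_induction_on_left' generalizing k with
  | algebraMap a =>
    rw [AlgHom.commutes, ExteriorAlgebra.exteriorPower, pow_zero, Polynomial.algebraMap_apply, Polynomial.coeff_C]
    split_ifs
    · exact Submodule.mem_one.2 ⟨a, rfl⟩
    · exact Submodule.zero_mem _
  | add x y i hx hy ihx ihy =>
    rw [map_add, Polynomial.coeff_add]
    exact Submodule.add_mem _ (ihx k) (ihy k)
  | mem_mul m hm i x hx ih =>
    obtain ⟨v, rfl⟩ := hm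
    rw [map_mul, Polynomial.coeff_mul, ExteriorAlgebra.exteriorPower, Nat.succ_eq_add_one, pow_succ']
    refine Submodule.sum_mem _ fun c _ => Submodule.mul_mem_mul ?_ (ih _)
    rw [hasseSchmidt, ExteriorAlgebra.lift_ι_apply]
    exact ⟨_, (toExtPoly_coeff _ _).symm⟩

/-- The coefficient of `wᵏ` of a Hasse–Schmidt derivation, as a self-map of `⋀ʳ M₀`. -/
def hsCoeff (f : M₀ →ₗ[ℤ] (ℕ →₀ M₀)) (r k : ℕ) (m : ⋀[ℤ]^r M₀) : ⋀[ℤ]^r M₀ :=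
  ⟨(hasseSchmidt f m).coeff k, hasseSchmidt_coeff_mem f r m m.2 k⟩

/-! ### Partitions and the bases of the exterior powers -/

/-- A partition: a non-increasing sequence `λ₁ ≥ λ₂ ≥ …` of natural numbers with finitely many
non-zero terms. The part `λ_{i+1}` is `l.1 i`. -/
abbrev Part : Type := {l : ℕ →₀ ℕ // Antitone l}

/-- The length of a partition: the number of its non-zero parts. -/
def Part.length (l : Part) : ℕ := l.1.support.card

/-- Partitions of length at most `r`. -/
abbrev PartLE (r : ℕ) : Type := {l : Part // l.length ≤ r}

/-- `[b]ʳ_λ = b_{λ_r} ∧ b_{1+λ_{r-1}} ∧ ⋯ ∧ b_{r-1+λ_1}` in `⋀ʳ M₀`. -/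
def wedge (r : ℕ) (l : Part) : ⋀[ℤ]^r M₀ :=
  exteriorPower.ιMulti ℤ r fun i : Fin r => b (i + l.1 (r - 1 - i))

/-- `(a_λ) ↦ ∑ a_λ [b]ʳ_λ`, where `λ` runs over the partitions of length at most `r`. It is
bijective since the `[b]ʳ_λ` form a basis of `⋀ʳ M₀`. -/
def wedgeSum (r : ℕ) : (PartLE r →₀ ℤ) →ₗ[ℤ] ⋀[ℤ]^r M₀ :=
  Finsupp.linearCombination ℤ fun l => wedge r l.1

/-- The Grassmann cone `𝒢_r`: the set of all `m₁ ∧ ⋯ ∧ m_r` in `⋀ʳ M₀`. -/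
def grassmannCone (r : ℕ) : Set (⋀[ℤ]^r M₀) :=
  Set.range (exteriorPower.ιMulti ℤ r : M₀ [⋀^Fin r]→ₗ[ℤ] ⋀[ℤ]^r M₀)

/-! ### Polynomial rings and Schur determinants -/

section Schur

variable {R : Type} [CommRing R]

/-- `E(z) = ∑ (-1)ⁱ eᵢ zⁱ`. -/
def seriesE (e : ℕ → R) : PowerSeries R := PowerSeries.mk fun n => (-1) ^ n * e n

/-- `1 / E(z)`, for a sequence with `e₀ = 1`. -/
def seriesH (e : ℕ → R) : PowerSeries R := PowerSeries.invOfUnit (seriesE e) 1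

/-- The bilateral sequence `(h_j)`: the coefficients of `1 / E(z)`, with `h_j = 0` for `j < 0`. -/
def h (e : ℕ → R) (j : ℤ) : R := if j < 0 then 0 else PowerSeries.coeff j.toNat (seriesH e)

/-- The Schur determinant `det (h_{λ_j - j + i})_{1 ≤ i, j ≤ r}`. -/
def schur (e : ℕ → R) (r : ℕ) (l : Part) : R :=
  Matrix.det (Matrix.of fun i j : Fin r => h e ((l.1 j : ℤ) - (j : ℤ) + (i : ℤ)))

end Schur

/-- `B_r = ℤ[e₁, …, e_r]`; the variable `X i` is `e_{i+1}`. -/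
abbrev B (r : ℕ) : Type := MvPolynomial (Fin r) ℤ

/-- `B_∞ = ℤ[e₁, e₂, …]`; the variable `X i` is `e_{i+1}`. -/
abbrev BInf : Type := MvPolynomial ℕ ℤ

/-- The sequence `1, e₁, …, e_r, 0, 0, …` in `B_r`. -/
def e (r : ℕ) : ℕ → B r
  | 0 => 1
  | n + 1 => if hn : n < r then MvPolynomial.X ⟨n, hn⟩ else 0

/-- The sequence `1, e₁, e₂, …` in `B_∞`. -/
def eInf : ℕ → BInf
  | 0 => 1
  | n + 1 => MvPolynomial.X n

/-- The inclusion `B_r ⊆ B_∞`. -/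
def inclB (r : ℕ) : B r →ₐ[ℤ] BInf := MvPolynomial.rename Fin.val

/-- `(a_λ) ↦ ∑ a_λ Δ_λ(H_r)`, where `λ` runs over the partitions of length at most `r`. It is
bijective since the `Δ_λ(H_r)` form a basis of `B_r`. -/
def schurSum (r : ℕ) : (PartLE r →₀ ℤ) →ₗ[ℤ] B r :=
  Finsupp.linearCombination ℤ fun l => schur (e r) r l.1

/-- The isomorphism `φ_r : B_r → ⋀ʳ M₀` with `Δ_λ(H_r) ↦ [b]ʳ_λ`. -/
def phi (r : ℕ) (p : B r) : ⋀[ℤ]^r M₀ := wedgeSum r (Function.invFun (schurSum r) p)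

/-- The Schur determinant `Δ_λ(H_∞)`. -/
def schurInf (l : Part) : BInf := schur eInf l.length l

/-- `(a_λ) ↦ ∑ a_λ Δ_λ(H_∞)`, where `λ` runs over all partitions. It is bijective since the
`Δ_λ(H_∞)` form a basis of `B_∞`. -/
def schurSumInf : (Part →₀ ℤ) →ₗ[ℤ] BInf := Finsupp.linearCombination ℤ schurInf

/-- The map `⋀ʳ M₀ → B_∞` with `[b]ʳ_λ ↦ Δ_λ(H_∞)` for all `λ` of length at most `r`. -/
def toBInf (r : ℕ) (m : ⋀[ℤ]^r M₀) : BInf :=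
  schurSumInf ((Function.invFun (wedgeSum r) m).mapDomain Subtype.val)

/-! ### The operators on `B_∞` and the residue -/

/-- A Hasse–Schmidt derivation `D(z) = ∑ D_k wᵏ`, `w = z⁻¹`, of `⋀ M₀` as a map
`B_∞ → B_∞[w]`: the additive map that sends `Δ_λ(H_∞)` to `∑_μ a_μ(w) Δ_μ(H_∞)`, where
`D(z) [b]ʳ_λ = ∑_μ a_μ(w) [b]ʳ_μ`. Here `r` is the length of `λ`; for `σ₋(z)` and `σ̄₋(z)` each
larger `r` gives the same `a_μ`. -/
def onBInf (f : M₀ →ₗ[ℤ] (ℕ →₀ M₀)) (p : BInf) : Polynomial BInf :=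
  (Function.invFun schurSumInf p).sum fun l a =>
    a • ∑ k ∈ (hasseSchmidt f (wedge l.length l)).support,
      Polynomial.monomial k (toBInf l.length (hsCoeff f l.length k (wedge l.length l)))

/-- `σ₋(z) : B_∞ → B_∞[z⁻¹]`, in the variable `w = z⁻¹`. -/
def sigmaMinusB (p : BInf) : Polynomial BInf := onBInf shiftMinus p

/-- `σ̄₋(z) : B_∞ → B_∞[z⁻¹]`, in the variable `w = z⁻¹`. -/
def sigmaBarMinusB (p : BInf) : Polynomial BInf := onBInf shiftBarMinus p

/-- The inclusion `B_∞[z⁻¹] → B_∞((z))`, with `w ↦ z⁻¹`. -/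
def toLaurent : Polynomial BInf →ₐ[BInf] LaurentSeries BInf :=
  Polynomial.aeval (HahnSeries.single (-1 : ℤ) (1 : BInf))

/-- `E_∞(z) σ₋(z) p` in `B_∞((z))`. -/
def gammaStar (p : BInf) : LaurentSeries BInf :=
  HahnSeries.ofPowerSeries ℤ BInf (seriesE eInf) * toLaurent (sigmaMinusB p)

/-- `E_∞(z)⁻¹ σ̄₋(z) p` in `B_∞((z))`. -/
def gamma (p : BInf) : LaurentSeries BInf :=
  HahnSeries.ofPowerSeries ℤ BInf (seriesH eInf) * toLaurent (sigmaBarMinusB p)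

/-- For `f = ∑ fᵢ zⁱ` and `g = ∑ gⱼ zʲ`, the series `f ⊗ g = ∑ₙ (∑_{i+j=n} fᵢ ⊗ gⱼ) zⁿ` in
`(B_∞ ⊗ B_∞)((z))`. -/
def tensorSeries (f g : LaurentSeries BInf) : LaurentSeries (BInf ⊗[ℤ] BInf) :=
  f.map (Algebra.TensorProduct.includeLeft : BInf →ₐ[ℤ] BInf ⊗[ℤ] BInf) *
    g.map (Algebra.TensorProduct.includeRight : BInf →ₐ[ℤ] BInf ⊗[ℤ] BInf)

/-- `Res_z`: the coefficient of `z⁻¹`. -/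
def residue {R : Type} [CommRing R] (f : LaurentSeries R) : R := f.coeff (-1)

/-- `p ∈ B_∞` corresponds to an element of the Grassmann cone `𝒢_∞`: for all sufficiently large
`s`, the polynomial `p` lies in `B_s` and `φ_s(p) ∈ 𝒢_s`. -/
def CorrespondsToCone (p : BInf) : Prop :=
  ∃ r : ℕ, ∀ s ≥ r, ∃ q : B s, inclB s q = p ∧ phi s q ∈ grassmannCone s

end GrassmannKP

end

/-!
The Jacobi–Trudi map `b_{i₀} ∧ ⋯ ∧ b_{i_{s-1}} ↦ det (h_{i_k - l})` inverts `φ_s`, and through it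
`σ₋(z)` and `σ̄₋(z)` become ring homomorphisms, multiplying the generating series of the `e_n` by
`1 - w z` and `(1 - w z)⁻¹`, where `w = z⁻¹` is treated as an independent variable. Expanding the
determinants along one column or one row shows that the coefficients of `E(z) σ₋(z)` are, up to
sign, the contractions with the dual basis `βᵢ`, and those of `E(z)⁻¹ σ̄₋(z)` the exterior
multiplications by `bᵢ`. Hence, for `p` corresponding to `x`, the residue is the image of the
Plücker form `-∑ᵢ (βᵢ ⌟ x) ⊗ (bᵢ ∧ x)` under an injective linear map. If this form vanishes and
`x ≠ 0`, then some primitive vector `u` satisfies `u ∧ x = 0`, so `x = u ∧ (d ⌟ x)` for a form `d`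
with `d u = 1`; the form of `d ⌟ x` vanishes too, and induction on the degree shows that `x` is
decomposable.
-/

noncomputable section

namespace GrassmannKP

section Polarization

variable {K M : Type*} [CommRing K] [AddCommGroup M] [Module K M]

/-- The contraction `d ⌟ x` of the exterior algebra by a linear form `d`. -/
abbrev contract (d : Module.Dual K M) : ExteriorAlgebra K M →ₗ[K] ExteriorAlgebra K M :=
  CliffordAlgebra.contractLeft (Q := (0 : QuadraticForm K M)) d

theorem contract_algebraMap (d : Module.Dual K M) (c : K) :
    contract d (algebraMap K (ExteriorAlgebra K M) c) = 0 :=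
  CliffordAlgebra.contractLeft_algebraMap ..

theorem contract_ι_mul (d : Module.Dual K M) (v : M) (x : ExteriorAlgebra K M) :
    contract d (ExteriorAlgebra.ι K v * x) = d v • x - ExteriorAlgebra.ι K v * contract d x :=
  CliffordAlgebra.contractLeft_ι_mul d v x

theorem exteriorAlgebra_left_induction {P : ExteriorAlgebra K M → Prop}
    (algebraMap : ∀ c : K, P (algebraMap K (ExteriorAlgebra K M) c))
    (add : ∀ x y, P x → P y → P (x + y))
    (ι_mul : ∀ x v, P x → P (ExteriorAlgebra.ι K v * x)) (x : ExteriorAlgebra K M) : P x :=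
  CliffordAlgebra.left_induction (0 : QuadraticForm K M) algebraMap add ι_mul x

theorem contract_mem {r : ℕ} {x : ExteriorAlgebra K M} (hx : x ∈ ⋀[K]^(r + 1) M)
    (d : Module.Dual K M) : contract d x ∈ ⋀[K]^r M := by
  suffices ∀ {n : ℕ} {y : ExteriorAlgebra K M}, y ∈ ⋀[K]^n M → contract d y ∈ ⋀[K]^(n - 1) M from
    this hx
  intro n y hy
  induction hy using Submodule.pow_induction_on_left' with
  | algebraMap c => rw [contract_algebraMap]; exact Submodule.zero_mem _
  | add y z i _ _ hy hz => rw [map_add]; exact Submodule.add_mem _ hy hz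
  | mem_mul m hm i y hy ih =>
    obtain ⟨v, rfl⟩ := hm
    rw [contract_ι_mul]
    refine Submodule.sub_mem _ (Submodule.smul_mem _ _ hy) ?_
    rcases i with _ | i
    · obtain ⟨c, rfl⟩ := Submodule.mem_one.1 (by simpa only [pow_zero] using hy)
      rw [contract_algebraMap, mul_zero]
      exact Submodule.zero_mem _
    · rw [Nat.succ_sub_one, ExteriorAlgebra.exteriorPower, pow_succ']
      exact Submodule.mul_mem_mul ⟨v, rfl⟩ ih

/-- The recursion step `(x, t) ↦ x ⊗ v - v ∧ t` that computes `polarize (v ∧ x)` from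
`t = polarize x`. -/
def polarizeStep :
    M →ₗ[K] (ExteriorAlgebra K M × ExteriorAlgebra K M ⊗[K] M) →ₗ[K] ExteriorAlgebra K M ⊗[K] M :=
  LinearMap.mk₂ K
    (fun v xt => xt.1 ⊗ₜ v -
      LinearMap.rTensorHom M (LinearMap.mul K (ExteriorAlgebra K M) (ExteriorAlgebra.ι K v)) xt.2)
    (fun v w xt => by
      simp only [map_add, TensorProduct.tmul_add, LinearMap.add_apply, add_sub_add_comm])
    (fun c v xt => by
      simp only [map_smul, TensorProduct.tmul_smul, LinearMap.smul_apply, smul_sub])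
    (fun v xt yu => by
      simp only [Prod.fst_add, Prod.snd_add, TensorProduct.add_tmul, map_add, add_sub_add_comm])
    (fun c v xt => by
      simp only [Prod.smul_fst, Prod.smul_snd, ← TensorProduct.smul_tmul', map_smul, smul_sub])

theorem polarizeStep_apply (v : M) (x : ExteriorAlgebra K M) (t : ExteriorAlgebra K M ⊗[K] M) :
    polarizeStep v (x, t) =
      x ⊗ₜ v - (LinearMap.mulLeft K (ExteriorAlgebra.ι K v)).rTensor M t :=
  rfl

theorem polarizeStep_polarizeStep (v : M) (x : ExteriorAlgebra K M)
    (t : ExteriorAlgebra K M ⊗[K] M) :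
    polarizeStep v (ExteriorAlgebra.ι K v * x, polarizeStep v (x, t)) = 0 := by
  rw [polarizeStep_apply, polarizeStep_apply, map_sub, LinearMap.rTensor_tmul,
    LinearMap.mulLeft_apply, sub_sub_cancel, ← LinearMap.rTensor_comp_apply,
    ← LinearMap.mulLeft_mul, ExteriorAlgebra.ι_sq_zero, LinearMap.mulLeft_zero_eq_zero,
    LinearMap.rTensor_zero, LinearMap.zero_apply]

/-- The polarization `x ↦ ∑ᵢ (βᵢ ⌟ x) ⊗ bᵢ` of the exterior algebra, for any basis `bᵢ` with dual
basis `βᵢ`. The recursion `v ∧ x ↦ x ⊗ v - v ∧ polarize x` avoids the choice of a basis. -/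
def polarize : ExteriorAlgebra K M →ₗ[K] ExteriorAlgebra K M ⊗[K] M :=
  CliffordAlgebra.foldr' (0 : QuadraticForm K M) polarizeStep
    (fun v x t => (polarizeStep_polarizeStep v x t).trans (zero_smul K t).symm) 0

theorem polarize_algebraMap (c : K) : polarize (algebraMap K (ExteriorAlgebra K M) c) = 0 :=
  (CliffordAlgebra.foldr'_algebraMap _ polarizeStep _ 0 c).trans (smul_zero c)

theorem polarize_ι_mul (v : M) (x : ExteriorAlgebra K M) :
    polarize (ExteriorAlgebra.ι K v * x) =
      x ⊗ₜ v - (LinearMap.mulLeft K (ExteriorAlgebra.ι K v)).rTensor M (polarize x) :=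
  CliffordAlgebra.foldr'_ι_mul _ polarizeStep _ 0 v x

theorem rid_lTensor_polarize (d : Module.Dual K M) (x : ExteriorAlgebra K M) :
    TensorProduct.rid K _ (d.lTensor _ (polarize x)) = contract d x := by
  induction x using exteriorAlgebra_left_induction with
  | algebraMap c =>
    rw [contract_algebraMap, polarize_algebraMap, map_zero, map_zero]
  | add x y hx hy => simp only [map_add, hx, hy]
  | ι_mul x v hx =>
    have h : ∀ t : ExteriorAlgebra K M ⊗[K] M, TensorProduct.rid K _ (d.lTensor _
        ((LinearMap.mulLeft K (ExteriorAlgebra.ι K v)).rTensor M t)) =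
        ExteriorAlgebra.ι K v * TensorProduct.rid K _ (d.lTensor _ t) := fun t => by
      induction t with
      | zero => simp
      | add t u ht hu => simp only [map_add, ht, hu, mul_add]
      | tmul y w => simp
    rw [contract_ι_mul, polarize_ι_mul, map_sub, map_sub, h, hx]
    simp

end Polarization

section Plucker

variable {K M : Type*} [CommRing K] [AddCommGroup M] [Module K M]

theorem polarize_contract (d : Module.Dual K M) (x : ExteriorAlgebra K M) :
    polarize (contract d x) = -(contract d).rTensor M (polarize x) := by
  induction x using exteriorAlgebra_left_induction with
  | algebraMap c => simp only [contract_algebraMap, polarize_algebraMap, map_zero, neg_zero]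
  | add x y hx hy => simp only [map_add, hx, hy, neg_add]
  | ι_mul x v hx =>
    have h : contract d ∘ₗ LinearMap.mulLeft K (ExteriorAlgebra.ι K v) =
        d v • LinearMap.id - LinearMap.mulLeft K (ExteriorAlgebra.ι K v) ∘ₗ contract d :=
      LinearMap.ext fun y => contract_ι_mul d v y
    rw [contract_ι_mul, map_sub, map_smul, polarize_ι_mul, polarize_ι_mul, hx, map_sub,
      LinearMap.rTensor_tmul, map_neg, ← LinearMap.rTensor_comp_apply,
      ← LinearMap.rTensor_comp_apply, h, LinearMap.rTensor_sub, LinearMap.rTensor_smul]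
    simp only [LinearMap.sub_apply, LinearMap.smul_apply, LinearMap.rTensor_id, LinearMap.id_apply]
    abel

/-- The Plücker form `∑ᵢ (βᵢ ⌟ x) ⊗ (bᵢ ∧ x)`, whose vanishing characterizes the decomposable
elements of an exterior power. -/
def plucker (x : ExteriorAlgebra K M) : ExteriorAlgebra K M ⊗[K] ExteriorAlgebra K M :=
  (LinearMap.mulRight K x ∘ₗ ExteriorAlgebra.ι K).lTensor _ (polarize x)

theorem lTensor_polarize_ιMulti_eq_zero {r : ℕ} (m : Fin r → M) {y : ExteriorAlgebra K M}
    (hy : ∀ k, ExteriorAlgebra.ι K (m k) * y = 0) :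
    (LinearMap.mulRight K y ∘ₗ ExteriorAlgebra.ι K).lTensor _
      (polarize (ExteriorAlgebra.ιMulti K r m)) = 0 := by
  induction r with
  | zero =>
    rw [ExteriorAlgebra.ιMulti_zero_apply, ← map_one (algebraMap K _), polarize_algebraMap,
      map_zero]
  | succ r ih =>
    rw [ExteriorAlgebra.ιMulti_succ_apply, polarize_ι_mul, map_sub, LinearMap.lTensor_tmul,
      LinearMap.comp_apply, LinearMap.mulRight_apply, hy 0, TensorProduct.tmul_zero, zero_sub,
      neg_eq_zero, ← LinearMap.comp_apply, LinearMap.lTensor_comp_rTensor,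
      ← LinearMap.rTensor_comp_lTensor, LinearMap.comp_apply,
      ih (Matrix.vecTail m) fun k => hy k.succ, map_zero]

theorem plucker_ιMulti {r : ℕ} (m : Fin r → M) : plucker (ExteriorAlgebra.ιMulti K r m) = 0 :=
  lTensor_polarize_ιMulti_eq_zero m fun k => by
    rw [ExteriorAlgebra.ιMulti_apply]
    exact ExteriorAlgebra.ι_mul_prod_list m k

theorem map_smulRight {A N P : Type*} [AddCommGroup A] [Module K A] [AddCommGroup N] [Module K N]
    [AddCommGroup P] [Module K P] (f : A →ₗ[K] N) (d : Module.Dual K M) (p : P) (t : A ⊗[K] M) :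
    TensorProduct.map f (d.smulRight p) t =
      f (TensorProduct.rid K A (d.lTensor A t)) ⊗ₜ p := by
  induction t with
  | zero => simp
  | add t u ht hu => simp only [map_add, ht, hu, TensorProduct.add_tmul]
  | tmul a m => simp [TensorProduct.smul_tmul]

theorem plucker_contract (d : Module.Dual K M) (x : ExteriorAlgebra K M) :
    plucker (contract d x) = TensorProduct.map (contract d) (contract d) (plucker x) := by
  have h : d.smulRight x = contract d ∘ₗ LinearMap.mulRight K x ∘ₗ ExteriorAlgebra.ι K +
      LinearMap.mulRight K (contract d x) ∘ₗ ExteriorAlgebra.ι K :=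
    LinearMap.ext fun v => eq_add_of_sub_eq (contract_ι_mul d v x).symm
  have hx : TensorProduct.map (contract d) (d.smulRight x) (polarize x) = 0 := by
    rw [map_smulRight, rid_lTensor_polarize, CliffordAlgebra.contractLeft_contractLeft,
      TensorProduct.zero_tmul]
  rw [h, TensorProduct.map_add_right, LinearMap.add_apply] at hx
  rw [plucker, plucker, polarize_contract, map_neg, ← LinearMap.comp_apply,
    LinearMap.lTensor_comp_rTensor, LinearMap.map_lTensor]
  exact neg_eq_of_add_eq_zero_left hx

theorem lift_flip_polarize {r : ℕ} {x : ExteriorAlgebra K M} (hx : x ∈ ⋀[K]^r M) :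
    TensorProduct.lift ((LinearMap.mul K (ExteriorAlgebra K M) ∘ₗ ExteriorAlgebra.ι K).flip)
      (polarize x) = (r : K) • x := by
  induction hx using Submodule.pow_induction_on_left' with
  | algebraMap c => rw [polarize_algebraMap, map_zero, Nat.cast_zero, zero_smul]
  | add x y i hx hy ihx ihy => rw [map_add, map_add, ihx, ihy, smul_add]
  | mem_mul m hm i x _ ih =>
    obtain ⟨v, rfl⟩ := hm
    have h (t : ExteriorAlgebra K M ⊗[K] M) :
        TensorProduct.lift ((LinearMap.mul K (ExteriorAlgebra K M) ∘ₗ ExteriorAlgebra.ι K).flip)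
          ((LinearMap.mulLeft K (ExteriorAlgebra.ι K v)).rTensor M t) =
        -(ExteriorAlgebra.ι K v * TensorProduct.lift
          ((LinearMap.mul K (ExteriorAlgebra K M) ∘ₗ ExteriorAlgebra.ι K).flip) t) := by
      induction t with
      | zero => simp
      | add t u ht hu => simp only [map_add, ht, hu, mul_add, neg_add]
      | tmul y w =>
        simp only [LinearMap.rTensor_tmul, LinearMap.mulLeft_apply, TensorProduct.lift.tmul,
          LinearMap.flip_apply, LinearMap.comp_apply, LinearMap.mul_apply', ← mul_assoc]
        rw [eq_neg_of_add_eq_zero_left (ExteriorAlgebra.ι_add_mul_swap w v), neg_mul]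
    rw [polarize_ι_mul, map_sub, h, ih, sub_neg_eq_add, mul_smul_comm, Nat.cast_succ, add_smul,
      one_smul, add_comm]
    rfl

end Plucker

section Decomposable

variable {K M κ : Type*} [CommRing K] [AddCommGroup M] [Module K M]

theorem polarize_eq_zero (𝒞 : Module.Basis κ K M) {x : ExteriorAlgebra K M}
    (hx : ∀ i, contract (𝒞.coord i) x = 0) : polarize x = 0 := by
  classical
  apply (TensorProduct.equivFinsuppOfBasisRight 𝒞).injective
  ext1 i
  rw [TensorProduct.equivFinsuppOfBasisRight_apply, rid_lTensor_polarize, hx, map_zero,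
    Finsupp.zero_apply]

theorem exists_plucker_eq_sum (𝒞 : Module.Basis κ K M) (x : ExteriorAlgebra K M) :
    ∃ s : Finset κ, (∀ i ∉ s, contract (𝒞.coord i) x = 0) ∧
      plucker x = ∑ i ∈ s, contract (𝒞.coord i) x ⊗ₜ (ExteriorAlgebra.ι K (𝒞 i) * x) := by
  classical
  set c := TensorProduct.equivFinsuppOfBasisRight 𝒞 (polarize x) with hc
  have hcoord (i : κ) : contract (𝒞.coord i) x = c i := by
    rw [hc, TensorProduct.equivFinsuppOfBasisRight_apply, rid_lTensor_polarize]
  refine ⟨c.support, fun i hi => ?_, ?_⟩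
  · rw [hcoord, Finsupp.notMem_support_iff.1 hi]
  · rw [plucker, ← (TensorProduct.equivFinsuppOfBasisRight 𝒞).symm_apply_apply (polarize x), ← hc,
      TensorProduct.equivFinsuppOfBasisRight_symm_apply, Finsupp.sum, map_sum]
    exact Finset.sum_congr rfl fun i _ => by rw [hcoord]; rfl

open scoped Classical in
instance [Module.Free K M] : Module.Free K (ExteriorAlgebra K M) :=
  letI := linearOrderOfSTO (WellOrderingRel (α := Module.Free.ChooseBasisIndex K M))
  .of_basis (Module.Free.chooseBasis K M).ExteriorAlgebra

variable [IsDomain K]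

theorem eq_zero_of_contract_eq_zero [CharZero K] (𝒞 : Module.Basis κ K M) {r : ℕ}
    {x : ExteriorAlgebra K M} (hx : x ∈ ⋀[K]^(r + 1) M)
    (hc : ∀ i, contract (𝒞.coord i) x = 0) : x = 0 := by
  have := Module.Free.of_basis 𝒞
  have h := lift_flip_polarize hx
  rw [polarize_eq_zero 𝒞 hc, map_zero] at h
  exact (smul_eq_zero.1 h.symm).resolve_left (Nat.cast_ne_zero.2 r.succ_ne_zero)

variable [IsPrincipalIdealRing K] [Module.Free K M]

theorem exists_eq_smul_of_ne_zero {v : M} (hv : v ≠ 0) :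
    ∃ (c : K) (u : M) (d : Module.Dual K M), c ≠ 0 ∧ v = c • u ∧ d u = 1 := by
  let 𝒞 := Module.Free.chooseBasis K M
  obtain ⟨c, hc⟩ :=
    (IsPrincipalIdealRing.principal (LinearMap.range (Module.Dual.eval K M v))).principal
  have hdvd (d : Module.Dual K M) : c ∣ d v := by
    rw [← Ideal.mem_span_singleton, Ideal.span, ← hc]
    exact ⟨d, rfl⟩
  obtain ⟨d, hd⟩ : c ∈ LinearMap.range (Module.Dual.eval K M v) :=
    hc ▸ Submodule.mem_span_singleton_self c
  have hc₀ : c ≠ 0 := by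
    rintro rfl
    exact hv (𝒞.ext_elem fun i => by simpa using hdvd (𝒞.coord i))
  choose q hq using fun i => hdvd (𝒞.coord i)
  have hsupp (i) : i ∈ (𝒞.repr v).support ↔ q i ≠ 0 := by
    rw [Finsupp.mem_support_iff, ← 𝒞.coord_apply, hq, mul_ne_zero_iff_left hc₀]
  have hvu : v = c • 𝒞.repr.symm ⟨(𝒞.repr v).support, q, hsupp⟩ :=
    𝒞.ext_elem fun i => by simpa using hq i
  refine ⟨c, _, d, hc₀, hvu, mul_left_cancel₀ hc₀ ?_⟩
  rw [← smul_eq_mul, ← map_smul, ← hvu, mul_one]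
  exact hd

variable [CharZero K]

theorem exists_ι_mul_eq_zero_of_plucker {r : ℕ} {x : ExteriorAlgebra K M}
    (hx : x ∈ ⋀[K]^(r + 1) M) (hp : plucker x = 0) (h₀ : x ≠ 0) :
    ∃ (u : M) (d : Module.Dual K M), d u = 1 ∧ ExteriorAlgebra.ι K u * x = 0 := by
  obtain ⟨i, hi⟩ : ∃ i, contract ((Module.Free.chooseBasis K M).coord i) x ≠ 0 := by
    by_contra! h
    exact h₀ (eq_zero_of_contract_eq_zero _ hx h)
  obtain ⟨f, hf⟩ := Module.Projective.exists_dual_ne_zero K hi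
  let v : M := TensorProduct.lid K M (f.rTensor M (polarize x))
  have hv : v ≠ 0 := by
    have h (d : Module.Dual K M) (t : ExteriorAlgebra K M ⊗[K] M) :
        d (TensorProduct.lid K M (f.rTensor M t)) =
          f (TensorProduct.rid K _ (d.lTensor _ t)) := by
      induction t with
      | zero => simp
      | add t u ht hu => simp only [map_add, ht, hu]
      | tmul y w => simp [mul_comm]
    refine fun hv => hf ?_
    rw [← rid_lTensor_polarize, ← h]
    exact (congrArg _ hv).trans (map_zero _)
  have hvx : ExteriorAlgebra.ι K v * x = 0 := by
    have h (g : M →ₗ[K] ExteriorAlgebra K M) (t : ExteriorAlgebra K M ⊗[K] M) :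
        g (TensorProduct.lid K M (f.rTensor M t)) =
          TensorProduct.lid K _ (f.rTensor _ (g.lTensor _ t)) := by
      induction t with
      | zero => simp
      | add t u ht hu => simp only [map_add, ht, hu]
      | tmul y w => simp
    refine (h (LinearMap.mulRight K x ∘ₗ ExteriorAlgebra.ι K) (polarize x)).trans ?_
    rw [← plucker, hp, map_zero, map_zero]
  obtain ⟨c, u, d, hc, hvu, hd⟩ := exists_eq_smul_of_ne_zero (K := K) hv
  rw [hvu, map_smul, smul_mul_assoc] at hvx
  exact ⟨u, d, hd, (smul_eq_zero.1 hvx).resolve_left hc⟩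

theorem exists_eq_smul_ιMulti_of_plucker {r : ℕ} {x : ExteriorAlgebra K M}
    (hx : x ∈ ⋀[K]^r M) (hp : plucker x = 0) :
    ∃ (c : K) (m : Fin r → M), x = c • ExteriorAlgebra.ιMulti K r m := by
  induction r generalizing x with
  | zero =>
    obtain ⟨c, rfl⟩ := Submodule.mem_one.1 (by simpa only [pow_zero] using hx)
    exact ⟨c, Fin.elim0, by
      rw [ExteriorAlgebra.ιMulti_zero_apply, Algebra.algebraMap_eq_smul_one]⟩
  | succ r ih =>
    by_cases h₀ : x = 0
    · exact ⟨0, 0, by rw [h₀, zero_smul]⟩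
    obtain ⟨u, d, hd, hu⟩ := exists_ι_mul_eq_zero_of_plucker hx hp h₀
    obtain ⟨c, m, hm⟩ := ih (contract_mem hx d) (by rw [plucker_contract, hp, map_zero])
    have h := contract_ι_mul d u x
    rw [hu, map_zero, hd, one_smul, eq_comm, sub_eq_zero] at h
    refine ⟨c, Fin.cons u m, ?_⟩
    rw [ExteriorAlgebra.ιMulti_succ_apply, h, hm, mul_smul_comm]
    rfl

theorem mem_range_ιMulti_iff_plucker_eq_zero {r : ℕ} {x : ExteriorAlgebra K M}
    (hx : x ∈ ⋀[K]^(r + 1) M) :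
    x ∈ Set.range (ExteriorAlgebra.ιMulti K (r + 1) (M := M)) ↔ plucker x = 0 := by
  constructor
  · rintro ⟨m, rfl⟩
    exact plucker_ιMulti m
  · intro hp
    obtain ⟨c, m, rfl⟩ := exists_eq_smul_ιMulti_of_plucker hx hp
    exact ⟨Function.update m 0 (c • m 0), by
      rw [AlternatingMap.map_update_smul, Function.update_eq_self]⟩

end Decomposable

theorem mem_grassmannCone_iff {r : ℕ} (x : ⋀[ℤ]^(r + 1) M₀) :
    x ∈ grassmannCone (r + 1) ↔ plucker (x : Ext) = 0 := by
  rw [← mem_range_ιMulti_iff_plucker_eq_zero x.2]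
  simp only [grassmannCone, Set.mem_range, ← exteriorPower.ιMulti_apply_coe, Subtype.ext_iff]

section DetForm

variable {K M R S N : Type*} [CommRing K] [AddCommGroup M] [Module K M] [CommRing R] [Algebra K R]
  [CommRing S] [Algebra K S] [AddCommGroup N] [Module K N] [Module R N] [IsScalarTower K R N]

theorem eq_of_forall_ιMulti {L L' : ExteriorAlgebra K M →ₗ[K] N} {r : ℕ}
    (h : ∀ m : Fin r → M, L (ExteriorAlgebra.ιMulti K r m) = L' (ExteriorAlgebra.ιMulti K r m))
    {x : ExteriorAlgebra K M} (hx : x ∈ ⋀[K]^r M) : L x = L' x := by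
  rw [← ExteriorAlgebra.ιMulti_span_fixedDegree] at hx
  exact LinearMap.eqOn_span (by rintro _ ⟨m, rfl⟩; exact h m) hx

/-- The alternating map `(m₀, …, m_{r-1}) ↦ det (g_l m_k)`. -/
def detAlternating (g : ℕ → M →ₗ[K] R) (r : ℕ) : M [⋀^Fin r]→ₗ[K] R where
  toMultilinearMap :=
    ((Matrix.detRowAlternating (n := Fin r) (R := R)).toMultilinearMap.restrictScalars
      K).compLinearMap fun _ => LinearMap.pi fun l : Fin r => g l
  map_eq_zero_of_eq' v i j h hij :=
    (Matrix.detRowAlternating (n := Fin r) (R := R)).map_eq_zero_of_eq _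
      (by ext l; simp only [h]) hij

/-- The linear form `m₀ ∧ ⋯ ∧ m_{r-1} ↦ det (g_l m_k)` on all exterior powers. -/
def detForm (g : ℕ → M →ₗ[K] R) : ExteriorAlgebra K M →ₗ[K] R :=
  ExteriorAlgebra.liftAlternating (detAlternating g)

theorem detForm_ιMulti (g : ℕ → M →ₗ[K] R) {r : ℕ} (m : Fin r → M) :
    detForm g (ExteriorAlgebra.ιMulti K r m) = (Matrix.of fun k l : Fin r => g l (m k)).det :=
  ExteriorAlgebra.liftAlternating_apply_ιMulti ..

theorem map_detForm (f : R →ₐ[K] S) (g : ℕ → M →ₗ[K] R) (x : ExteriorAlgebra K M) :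
    f (detForm g x) = detForm (fun l => f.toLinearMap ∘ₗ g l) x := by
  suffices f.toLinearMap ∘ₗ detForm g = detForm fun l => f.toLinearMap ∘ₗ g l from
    LinearMap.congr_fun this x
  refine ExteriorAlgebra.lhom_ext fun r => AlternatingMap.ext fun m => ?_
  simp only [LinearMap.compAlternatingMap_apply, LinearMap.comp_apply, detForm_ιMulti,
    AlgHom.toLinearMap_apply, AlgHom.map_det]
  rfl

theorem polarize_ιMulti {r : ℕ} (m : Fin (r + 1) → M) :
    polarize (ExteriorAlgebra.ιMulti K (r + 1) m) =
      ∑ k : Fin (r + 1), (-1 : K) ^ (k : ℕ) •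
        ExteriorAlgebra.ιMulti K r (m ∘ k.succAbove) ⊗ₜ[K] m k := by
  induction r with
  | zero =>
    rw [ExteriorAlgebra.ιMulti_succ_apply, polarize_ι_mul, ExteriorAlgebra.ιMulti_zero_apply,
      ← map_one (algebraMap K _), polarize_algebraMap]
    simp
  | succ r ih =>
    rw [ExteriorAlgebra.ιMulti_succ_apply, polarize_ι_mul, ih, Fin.sum_univ_succ (n := r + 1),
      sub_eq_add_neg, map_sum, ← Finset.sum_neg_distrib]
    congr 1
    · simp [Matrix.vecTail, Function.comp_def]
    · refine Finset.sum_congr rfl fun k _ => ?_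
      have hsucc : ExteriorAlgebra.ιMulti K (r + 1) (m ∘ k.succ.succAbove) =
          ExteriorAlgebra.ι K (m 0) *
            ExteriorAlgebra.ιMulti K r (Matrix.vecTail m ∘ k.succAbove) := by
        rw [ExteriorAlgebra.ιMulti_succ_apply]
        simp [Matrix.vecTail, Function.comp_def]
      rw [map_smul, LinearMap.rTensor_tmul, LinearMap.mulLeft_apply, Fin.val_succ, pow_succ,
        mul_neg_one, hsucc]
      exact (neg_smul (M := ExteriorAlgebra K M ⊗[K] M) ((-1 : K) ^ (k : ℕ)) _).symm

/-- The linear map `x ⊗ m ↦ detForm g x • u m`; on polarizations it is the Laplace expansion along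
a last column `u`. -/
def detExpand (g : ℕ → M →ₗ[K] R) (u : M →ₗ[K] N) : ExteriorAlgebra K M ⊗[K] M →ₗ[K] N :=
  TensorProduct.lift ((Algebra.lsmul K K N).toLinearMap.compl₁₂ (detForm g) u)

theorem detExpand_tmul (g : ℕ → M →ₗ[K] R) (u : M →ₗ[K] N) (x : ExteriorAlgebra K M) (m : M) :
    detExpand g u (x ⊗ₜ m) = detForm g x • u m :=
  rfl

theorem map_detExpand {N' : Type*} [AddCommGroup N'] [Module K N'] [Module R N']
    [IsScalarTower K R N'] (φ : N →ₗ[R] N') (g : ℕ → M →ₗ[K] R) (u : M →ₗ[K] N)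
    (t : ExteriorAlgebra K M ⊗[K] M) :
    φ (detExpand g u t) = detExpand g (φ.restrictScalars K ∘ₗ u) t := by
  induction t with
  | zero => simp
  | add t u ht hu => simp only [map_add, ht, hu]
  | tmul x m => simp [detExpand_tmul]

theorem detExpand_sub (g : ℕ → M →ₗ[K] R) (u v : M →ₗ[K] N) :
    detExpand g (u - v) = detExpand g u - detExpand g v :=
  TensorProduct.ext' fun x m => by simp [detExpand_tmul, smul_sub]

theorem detExpand_sum_smul {α : Type*} (s : Finset α) (a : α → R) (g : ℕ → M →ₗ[K] R)
    (u : α → M →ₗ[K] N) :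
    detExpand g (∑ c ∈ s, a c • u c) = ∑ c ∈ s, a c • detExpand g (u c) :=
  TensorProduct.ext' fun x m => by
    simp [detExpand_tmul, LinearMap.sum_apply, Finset.smul_sum, smul_comm (detForm g x)]

theorem detExpand_linearMap_comp (g : ℕ → M →ₗ[K] R) (d : Module.Dual K M)
    (t : ExteriorAlgebra K M ⊗[K] M) :
    detExpand g (Algebra.linearMap K R ∘ₗ d) t =
      detForm g (TensorProduct.rid K _ (d.lTensor _ t)) := by
  induction t with
  | zero => simp
  | add t u ht hu => simp only [map_add, ht, hu]
  | tmul x m =>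
    rw [detExpand_tmul, LinearMap.lTensor_tmul, TensorProduct.rid_tmul, map_smul, smul_eq_mul,
      mul_comm, Algebra.smul_def, LinearMap.comp_apply, Algebra.linearMap_apply]

variable [Algebra R S] [IsScalarTower K R S]

theorem detExpand_polarize (g : ℕ → M →ₗ[K] R) (u : M →ₗ[K] S) {r : ℕ}
    {x : ExteriorAlgebra K M} (hx : x ∈ ⋀[K]^(r + 1) M) :
    detExpand g u (polarize x) = (-1) ^ r *
      detForm (Function.update (fun l => (IsScalarTower.toAlgHom K R S).toLinearMap ∘ₗ g l) r u)
        x := by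
  refine eq_of_forall_ιMulti (L := detExpand g u ∘ₗ polarize)
    (L' := LinearMap.mulLeft K ((-1) ^ r) ∘ₗ detForm _) (fun m => ?_) hx
  simp only [LinearMap.comp_apply, LinearMap.mulLeft_apply, polarize_ιMulti, map_sum, map_smul,
    detExpand_tmul, detForm_ιMulti, Function.comp_apply]
  rw [Matrix.det_succ_column _ (Fin.last r), Finset.mul_sum]
  refine Finset.sum_congr rfl fun k _ => ?_
  have hminor : (Matrix.of fun k l : Fin (r + 1) => Function.update (fun l =>
      (IsScalarTower.toAlgHom K R S).toLinearMap ∘ₗ g l) r u l (m k)).submatrix k.succAbove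
        (Fin.last r).succAbove =
      (Matrix.of fun j l : Fin r => g l (m (k.succAbove j))).map (algebraMap R S) := by
    ext j l
    simp [Function.update_of_ne l.2.ne]
  have hsign : ((-1 : S) ^ r) * (-1) ^ r = 1 := by rw [← mul_pow, neg_one_mul, neg_neg, one_pow]
  rw [hminor, ← RingHom.mapMatrix_apply, ← RingHom.map_det, Matrix.of_apply, Fin.val_last,
    Function.update_self, pow_add, Algebra.smul_def, Algebra.smul_def, map_pow, map_neg, map_one]
  linear_combination (-((-1) ^ (k : ℕ) * u (m k) * algebraMap R S
    (Matrix.of fun j l : Fin r => g l (m (k.succAbove j))).det)) * hsign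

theorem detForm_eq_zero_of_eq {g : ℕ → M →ₗ[K] R} {r c d : ℕ} (hc : c < r) (hd : d < r)
    (hcd : c ≠ d) (h : g c = g d) {x : ExteriorAlgebra K M} (hx : x ∈ ⋀[K]^r M) :
    detForm g x = 0 := by
  refine eq_of_forall_ιMulti (L' := 0) (fun m => ?_) hx
  rw [detForm_ιMulti, LinearMap.zero_apply]
  exact Matrix.det_zero_of_column_eq (i := ⟨c, hc⟩) (j := ⟨d, hd⟩) (by simpa using hcd)
    fun k => by simp [h]

theorem detExpand_self_polarize (g : ℕ → M →ₗ[K] R) {r c : ℕ} (hc : c < r)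
    {x : ExteriorAlgebra K M} (hx : x ∈ ⋀[K]^(r + 1) M) : detExpand g (g c) (polarize x) = 0 := by
  rw [detExpand_polarize g (g c) hx, detForm_eq_zero_of_eq (hc.trans r.lt_succ_self) r.lt_succ_self
    hc.ne _ hx, mul_zero]
  rw [Function.update_of_ne hc.ne, Function.update_self]
  rfl

theorem det_eq_of_forall_col_eq_smul_add_succ {n : ℕ}
    {A B : Matrix (Fin (n + 1)) (Fin (n + 1)) R} (c : R)
    (hlast : ∀ i, A i (Fin.last n) = B i (Fin.last n))
    (h : ∀ i (j : Fin n), A i j.castSucc = B i j.castSucc + c * A i j.succ) :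
    A.det = B.det := by
  have hrev : (A.submatrix Fin.revPerm Fin.revPerm).det =
      (B.submatrix Fin.revPerm Fin.revPerm).det := by
    refine Matrix.det_eq_of_forall_col_eq_smul_add_pred (fun _ => c) (fun i => ?_) fun i j => ?_
    · simpa using hlast i.rev
    · simpa [Fin.rev_succ, Fin.rev_castSucc] using h i.rev j.rev
  simpa using hrev

theorem detForm_eq_detExpand_polarize {g : ℕ → M →ₗ[K] R} {G : ℕ → M →ₗ[K] S} (c : S)
    (hG : ∀ l m, G l m = algebraMap R S (g l m) + c * G (l + 1) m) {r : ℕ}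
    {x : ExteriorAlgebra K M} (hx : x ∈ ⋀[K]^(r + 1) M) :
    detForm G x = (-1) ^ r * detExpand g (G r) (polarize x) := by
  rw [detExpand_polarize g (G r) hx, ← mul_assoc, ← mul_pow, neg_one_mul, neg_neg, one_pow,
    one_mul]
  refine eq_of_forall_ιMulti (fun m => ?_) hx
  rw [detForm_ιMulti, detForm_ιMulti]
  refine det_eq_of_forall_col_eq_smul_add_succ c (fun i => ?_) fun i j => ?_
  · rw [Matrix.of_apply, Matrix.of_apply, Fin.val_last, Function.update_self]
  · rw [Matrix.of_apply, Matrix.of_apply, Matrix.of_apply, Fin.val_castSucc,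
      Function.update_of_ne j.2.ne, Fin.val_succ, hG j]
    rfl

theorem map_detForm_eq_detForm_contract {g : ℕ → M →ₗ[K] R} {G : ℕ → M →ₗ[K] S} (c : S)
    (hG : ∀ l m, G l m = algebraMap R S (g l m) + c * G (l + 1) m) {r : ℕ} (φ : S →ₗ[R] R)
    (d : Module.Dual K M) (a : ℕ → R)
    (hφ : ∀ m, φ (G r m) = algebraMap K R (d m) - ∑ l ∈ Finset.range r, a l * g l m)
    {x : ExteriorAlgebra K M} (hx : x ∈ ⋀[K]^(r + 1) M) :
    φ (detForm G x) = (-1) ^ r * detForm g (contract d x) := by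
  have hu : φ.restrictScalars K ∘ₗ G r =
      Algebra.linearMap K R ∘ₗ d - ∑ l ∈ Finset.range r, a l • g l :=
    LinearMap.ext fun m => by
      simp only [LinearMap.comp_apply, LinearMap.restrictScalars_apply, hφ, LinearMap.sub_apply,
        LinearMap.sum_apply, LinearMap.smul_apply, Algebra.linearMap_apply, smul_eq_mul]
  have hrange : ∑ l ∈ Finset.range r, a l • detExpand g (g l) (polarize x) = 0 :=
    Finset.sum_eq_zero fun l hl => by
      rw [detExpand_self_polarize g (Finset.mem_range.1 hl) hx, smul_zero]
  have hsign : ((-1) ^ r : S) = algebraMap R S ((-1) ^ r) := by simp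
  rw [detForm_eq_detExpand_polarize c hG hx, hsign, ← Algebra.smul_def, map_smul, smul_eq_mul,
    map_detExpand, hu, detExpand_sub, detExpand_sum_smul, LinearMap.sub_apply,
    LinearMap.sum_apply, detExpand_linearMap_comp, rid_lTensor_polarize]
  simp only [LinearMap.smul_apply, hrange, sub_zero]

theorem det_cons_pow {r : ℕ} (A : Fin r → Fin (r + 1) → R) (c : R) :
    (Matrix.of (Fin.cons (fun l => c ^ (r - (l : ℕ))) A : Fin (r + 1) → Fin (r + 1) → R)).det =
      (-1) ^ r * (Matrix.of fun k l : Fin r => A k l.castSucc - c * A k l.succ).det := by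
  let D : Matrix (Fin (r + 1)) (Fin (r + 1)) R := Matrix.of
    (Fin.cons (Fin.snoc (α := fun _ => R) (fun _ => 0) 1) fun k =>
      Fin.snoc (α := fun _ => R) (fun l => A k l.castSucc - c * A k l.succ) (A k (Fin.last r)))
  have hD : (Matrix.of (Fin.cons (fun l => c ^ (r - (l : ℕ))) A :
      Fin (r + 1) → Fin (r + 1) → R)).det = D.det := by
    refine det_eq_of_forall_col_eq_smul_add_succ c (fun i => ?_) fun i j => ?_
    · refine Fin.cases ?_ (fun k => ?_) i <;> simp [D]
    · refine Fin.cases ?_ (fun k => ?_) i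
      · have : r - (j : ℕ) = r - (j + 1 : ℕ) + 1 := by omega
        simp [D, this, pow_succ, mul_comm]
      · simp [D]
  have hminor : D.submatrix Fin.succ Fin.castSucc =
      Matrix.of fun k l : Fin r => A k l.castSucc - c * A k l.succ := by
    ext k l
    simp [D]
  rw [hD, Matrix.det_succ_row_zero, Fin.sum_univ_castSucc,
    Finset.sum_eq_zero fun i _ => by simp [D]]
  simp [D, ← hminor, Fin.succAbove_last]

theorem map_det_cons {r : ℕ} (φ : S →ₗ[R] R) (w : Fin (r + 1) → S)
    (A : Fin r → Fin (r + 1) → R) :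
    φ (Matrix.of (Fin.cons w fun k l => algebraMap R S (A k l) :
        Fin (r + 1) → Fin (r + 1) → S)).det =
      (Matrix.of (Fin.cons (φ ∘ w) A : Fin (r + 1) → Fin (r + 1) → R)).det := by
  rw [Matrix.det_succ_row_zero, Matrix.det_succ_row_zero, map_sum]
  refine Finset.sum_congr rfl fun l _ => ?_
  have hminor : (Matrix.of (Fin.cons w fun k l => algebraMap R S (A k l) :
      Fin (r + 1) → Fin (r + 1) → S)).submatrix Fin.succ l.succAbove =
      (algebraMap R S).mapMatrix (Matrix.of fun k j => A k (l.succAbove j)) := by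
    ext k j
    simp
  have hminor' : (Matrix.of (Fin.cons (φ ∘ w) A : Fin (r + 1) → Fin (r + 1) → R)).submatrix
      Fin.succ l.succAbove = Matrix.of fun k j => A k (l.succAbove j) := by
    ext k j
    simp
  have hsign : ((-1) ^ (l : ℕ) : S) = algebraMap R S ((-1) ^ (l : ℕ)) := by simp
  rw [hminor, hminor', ← RingHom.map_det, hsign, mul_right_comm, ← map_mul, ← Algebra.smul_def,
    map_smul, smul_eq_mul, mul_right_comm]
  rfl

theorem map_detForm_eq_detForm_ι_mul {g : ℕ → M →ₗ[K] R} {G : ℕ → M →ₗ[K] S} (c : S)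
    (hG : ∀ l m, G l m = algebraMap R S (g l m) - c * algebraMap R S (g (l + 1) m)) {r : ℕ}
    (φ : S →ₗ[R] R) (v : M) (hφ : ∀ l ≤ r, φ (c ^ (r - l)) = g l v)
    {x : ExteriorAlgebra K M} (hx : x ∈ ⋀[K]^r M) :
    φ (detForm G x) = (-1) ^ r * detForm g (ExteriorAlgebra.ι K v * x) := by
  refine eq_of_forall_ιMulti (L := φ.restrictScalars K ∘ₗ detForm G)
    (L' := LinearMap.mulLeft K ((-1) ^ r) ∘ₗ detForm g ∘ₗ
      LinearMap.mulLeft K (ExteriorAlgebra.ι K v)) (fun m => ?_) hx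
  have hcons : ExteriorAlgebra.ι K v * ExteriorAlgebra.ιMulti K r m =
      ExteriorAlgebra.ιMulti K (r + 1) (Fin.cons v m) := by
    rw [ExteriorAlgebra.ιMulti_succ_apply]
    simp [Matrix.vecTail, Function.comp_def]
  have hrow : Fin.cons (φ ∘ fun l : Fin (r + 1) => c ^ (r - (l : ℕ)))
      (fun k (l : Fin (r + 1)) => g l (m k)) =
      (fun k l => g l (Fin.cons (α := fun _ => M) v m k) : Fin (r + 1) → Fin (r + 1) → R) := by
    refine funext (Fin.cases (funext fun l => ?_) fun k => ?_)
    · simp [hφ l (Nat.lt_succ_iff.1 l.2)]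
    · simp
  have hdet := congrArg φ (det_cons_pow (fun k (l : Fin (r + 1)) => algebraMap R S (g l (m k))) c)
  rw [map_det_cons φ, hrow] at hdet
  have hsign : ((-1) ^ r : S) = algebraMap R S ((-1) ^ r) := by simp
  rw [hsign, ← Algebra.smul_def, map_smul, smul_eq_mul] at hdet
  simp only [LinearMap.comp_apply, LinearMap.coe_restrictScalars, LinearMap.mulLeft_apply, hcons,
    detForm_ιMulti, hG, hdet, ← mul_assoc, ← mul_pow, neg_one_mul, neg_neg, one_pow, one_mul]
  rfl

end DetForm

section LaurentCoefficients

variable {R : Type*} [CommRing R]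

theorem laurentSeries_coeff_mul_eq_sum {F G : LaurentSeries R} {a : ℤ} {s : Finset ℕ} (m : ℤ)
    (hG : ∀ k < -a, G.coeff k = 0) (hF : ∀ n ∉ s, F.coeff (m + a - n) = 0) :
    (F * G).coeff m = ∑ n ∈ s, F.coeff (m + a - n) * G.coeff (n - a) := by
  rw [HahnSeries.coeff_mul]
  refine Finset.sum_of_injOn (fun ij => (ij.2 + a).toNat) ?_ ?_ ?_ ?_
  · intro ij hij kl hkl h
    simp only [Finset.mem_coe, Finset.mem_antidiagonal, HahnSeries.mem_support] at hij hkl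
    have h₁ := not_lt.1 (mt (hG ij.2) hij.2.1)
    have h₂ := not_lt.1 (mt (hG kl.2) hkl.2.1)
    ext <;> simp only at h <;> omega
  · intro ij hij
    simp only [Finset.mem_coe, Finset.mem_antidiagonal, HahnSeries.mem_support] at hij ⊢
    have h₁ := not_lt.1 (mt (hG ij.2) hij.2.1)
    by_contra hn
    refine hij.1 ?_
    rw [← hF _ hn]
    congr 1
    omega
  · intro n _ hn
    by_contra h
    refine hn ⟨(m + a - n, n - a), ?_, by simp⟩
    simp only [Finset.mem_coe, Finset.mem_antidiagonal, HahnSeries.mem_support]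
    exact ⟨left_ne_zero_of_mul h, right_ne_zero_of_mul h, by ring⟩
  · intro ij hij
    simp only [Finset.mem_antidiagonal, HahnSeries.mem_support] at hij
    have h₁ := not_lt.1 (mt (hG ij.2) hij.2.1)
    rw [Int.toNat_of_nonneg (by omega)]
    congr 2 <;> omega

theorem laurentSeries_coeff_one_sub_mul (F : LaurentSeries R) (c : R) (n : ℤ) :
    (((1 - PowerSeries.C c * PowerSeries.X : PowerSeries R) : LaurentSeries R) * F).coeff n =
      F.coeff n - c * F.coeff (n - 1) := by
  rw [PowerSeries.coe_sub, PowerSeries.coe_one, PowerSeries.coe_mul, PowerSeries.coe_X,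
    PowerSeries.coe_C, sub_mul, one_mul, HahnSeries.coeff_sub, HahnSeries.C_apply,
    HahnSeries.single_mul_single, zero_add, mul_one, HahnSeries.coeff_single_mul]

/-- The coefficient of `zᵏ` in `F(z) P(z⁻¹)`. -/
def coeffMul (F : LaurentSeries R) (k : ℤ) : Polynomial R →ₗ[R] R :=
  Polynomial.lsum fun j => F.coeff (k + j) • LinearMap.id

theorem coeffMul_monomial (F : LaurentSeries R) (k : ℤ) (j : ℕ) (c : R) :
    coeffMul F k (Polynomial.monomial j c) = F.coeff (k + j) * c := by
  simp [coeffMul, Polynomial.lsum_apply, Polynomial.sum_monomial_index]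

theorem coeffMul_C (F : LaurentSeries R) (k : ℤ) (c : R) :
    coeffMul F k (Polynomial.C c) = F.coeff k * c := by
  rw [← Polynomial.monomial_zero_left, coeffMul_monomial, Nat.cast_zero, add_zero]

theorem coeffMul_X_pow (F : LaurentSeries R) (k : ℤ) (j : ℕ) :
    coeffMul F k (Polynomial.X ^ j) = F.coeff (k + j) := by
  rw [← Polynomial.monomial_one_right_eq_X_pow, coeffMul_monomial, mul_one]

theorem coeffMul_X_mul (F : LaurentSeries R) (k : ℤ) (P : Polynomial R) :
    coeffMul F k (Polynomial.X * P) = coeffMul F (k + 1) P := by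
  induction P using Polynomial.induction_on' with
  | add P Q hP hQ => rw [mul_add, map_add, map_add, hP, hQ]
  | monomial j c =>
    rw [Polynomial.X_mul_monomial, coeffMul_monomial, coeffMul_monomial, Nat.cast_succ,
      add_assoc, add_comm (1 : ℤ)]

theorem coeffMul_X_pow_mul (F : LaurentSeries R) (k : ℤ) (j : ℕ) (P : Polynomial R) :
    coeffMul F k (Polynomial.X ^ j * P) = coeffMul F (k + j) P := by
  induction j generalizing k with
  | zero => simp
  | succ j ih =>
    rw [pow_succ', mul_assoc, coeffMul_X_mul, ih, Nat.cast_succ, add_right_comm, add_assoc]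

end LaurentCoefficients

section Sequences

variable {R S : Type} [CommRing R] [CommRing S]

theorem h_eq_coeff_seriesH (e : ℕ → R) (n : ℤ) :
    h e n = (seriesH e : LaurentSeries R).coeff n := by
  rw [PowerSeries.coeff_coe, h]
  split_ifs with hn
  · rfl
  · rw [show n.toNat = n.natAbs by omega]

theorem h_of_neg (e : ℕ → R) {n : ℤ} (hn : n < 0) : h e n = 0 := if_pos hn

theorem seriesE_mul_seriesH {e : ℕ → R} (he : e 0 = 1) : seriesE e * seriesH e = 1 :=
  PowerSeries.mul_invOfUnit _ _ (by simp [seriesE, he])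

theorem seriesH_eq_of_mul_eq_one {e : ℕ → R} (he : e 0 = 1) {F : PowerSeries R}
    (hF : seriesE e * F = 1) : seriesH e = F :=
  left_inv_eq_right_inv ((mul_comm _ _).trans (seriesE_mul_seriesH he)) hF

theorem h_zero {e : ℕ → R} (he : e 0 = 1) : h e 0 = 1 := by
  have := congrArg (PowerSeries.coeff 0) (seriesE_mul_seriesH he)
  simpa [h, seriesE, he] using this

theorem map_seriesE (f : R →+* S) (e : ℕ → R) :
    PowerSeries.map f (seriesE e) = seriesE fun n => f (e n) := by
  ext n
  simp [seriesE]

theorem map_seriesH (f : R →+* S) {e : ℕ → R} (he : e 0 = 1) :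
    PowerSeries.map f (seriesH e) = seriesH fun n => f (e n) := by
  refine (seriesH_eq_of_mul_eq_one (by rw [he, map_one]) ?_).symm
  rw [← map_seriesE, ← map_mul, seriesE_mul_seriesH he, map_one]

theorem map_h (f : R →+* S) {e : ℕ → R} (he : e 0 = 1) (n : ℤ) :
    f (h e n) = h (fun n => f (e n)) n := by
  rw [h, h, ← map_seriesH f he]
  split_ifs <;> simp

open Polynomial in
/-- The sequence in `R[w]` with generating series `(1 - w z) E(z)`; it describes the action of
`σ₋(z)` on symmetric functions. -/
def eSigma (e : ℕ → R) : ℕ → R[X]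
  | 0 => C (e 0)
  | n + 1 => C (e (n + 1)) + X * C (e n)

open Polynomial in
/-- The sequence in `R[w]` with generating series `E(z) / (1 - w z)`; it describes the action of
`σ̄₋(z)` on symmetric functions. -/
def eSigmaBar (e : ℕ → R) : ℕ → R[X]
  | 0 => C (e 0)
  | n + 1 => C (e (n + 1)) - X * eSigmaBar e n

theorem eSigma_zero {e : ℕ → R} (he : e 0 = 1) : eSigma e 0 = 1 := by simp [eSigma, he]

theorem eSigmaBar_zero {e : ℕ → R} (he : e 0 = 1) : eSigmaBar e 0 = 1 := by simp [eSigmaBar, he]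

theorem seriesE_eSigma (e : ℕ → R) :
    seriesE (eSigma e) = (1 - PowerSeries.C Polynomial.X * PowerSeries.X) *
      PowerSeries.map Polynomial.C (seriesE e) := by
  ext1 n
  rw [sub_mul, one_mul, map_sub, mul_assoc, PowerSeries.coeff_C_mul]
  cases n with
  | zero => simp [seriesE, eSigma]
  | succ n =>
    simp only [PowerSeries.coeff_succ_X_mul, seriesE, PowerSeries.coeff_mk, PowerSeries.coeff_map,
      map_mul, map_pow, map_neg, map_one, eSigma]
    ring

theorem one_sub_mul_seriesE_eSigmaBar (e : ℕ → R) :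
    (1 - PowerSeries.C Polynomial.X * PowerSeries.X) * seriesE (eSigmaBar e) =
      PowerSeries.map Polynomial.C (seriesE e) := by
  ext1 n
  rw [sub_mul, one_mul, map_sub, mul_assoc, PowerSeries.coeff_C_mul]
  cases n with
  | zero => simp [seriesE, eSigmaBar]
  | succ n =>
    simp only [PowerSeries.coeff_succ_X_mul, seriesE, PowerSeries.coeff_mk, PowerSeries.coeff_map,
      map_mul, map_pow, map_neg, map_one, eSigmaBar]
    ring

theorem one_sub_mul_seriesH_eSigma {e : ℕ → R} (he : e 0 = 1) :
    (1 - PowerSeries.C Polynomial.X * PowerSeries.X) * seriesH (eSigma e) =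
      seriesH fun n => Polynomial.C (e n) := by
  refine (seriesH_eq_of_mul_eq_one (by rw [he, map_one]) ?_).symm
  rw [← map_seriesE, ← mul_assoc, mul_comm (PowerSeries.map _ _), ← seriesE_eSigma,
    seriesE_mul_seriesH (eSigma_zero he)]

theorem seriesH_eSigmaBar {e : ℕ → R} (he : e 0 = 1) :
    seriesH (eSigmaBar e) = (1 - PowerSeries.C Polynomial.X * PowerSeries.X) *
      seriesH fun n => Polynomial.C (e n) := by
  refine seriesH_eq_of_mul_eq_one (eSigmaBar_zero he) ?_
  rw [← mul_assoc, mul_comm (seriesE _), one_sub_mul_seriesE_eSigmaBar, map_seriesE,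
    seriesE_mul_seriesH (by rw [he, map_one])]

theorem h_eSigma {e : ℕ → R} (he : e 0 = 1) (n : ℤ) :
    h (eSigma e) n = Polynomial.C (h e n) + Polynomial.X * h (eSigma e) (n - 1) := by
  rw [map_h _ he, h_eq_coeff_seriesH (fun n => Polynomial.C (e n)),
    ← one_sub_mul_seriesH_eSigma he, PowerSeries.coe_mul, laurentSeries_coeff_one_sub_mul,
    h_eq_coeff_seriesH, h_eq_coeff_seriesH, sub_add_cancel]

theorem h_eSigmaBar {e : ℕ → R} (he : e 0 = 1) (n : ℤ) :
    h (eSigmaBar e) n = Polynomial.C (h e n) - Polynomial.X * Polynomial.C (h e (n - 1)) := by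
  rw [h_eq_coeff_seriesH, seriesH_eSigmaBar he, PowerSeries.coe_mul,
    laurentSeries_coeff_one_sub_mul, ← h_eq_coeff_seriesH, ← h_eq_coeff_seriesH, map_h _ he,
    map_h _ he]

theorem coeff_h_eSigma {e : ℕ → R} (he : e 0 = 1) (n : ℤ) (j : ℕ) :
    (h (eSigma e) n).coeff j = h e (n - j) := by
  induction j generalizing n with
  | zero => simp [h_eSigma he n]
  | succ j ih =>
    rw [h_eSigma he, Polynomial.coeff_add, Polynomial.coeff_C_succ, zero_add,
      Polynomial.coeff_X_mul, ih, Nat.cast_succ, sub_sub, add_comm]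

theorem h_eSigma_eq_sum {e : ℕ → R} (he : e 0 = 1) (i l : ℕ) :
    h (eSigma e) (i - l) =
      ∑ j ∈ Finset.range (i + 1), Polynomial.monomial j (h e (((i - j : ℕ) : ℤ) - l)) := by
  ext j
  simp only [Polynomial.finsetSum_coeff, Polynomial.coeff_monomial, Finset.sum_ite_eq',
    Finset.mem_range, coeff_h_eSigma he]
  split_ifs with hj
  · congr 1
    omega
  · exact h_of_neg e (by omega)

end Sequences

section VertexOperators

variable {R S : Type} [CommRing R] [CommRing S]

/-- The basis `b₀, b₁, …` of `M₀`. -/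
def bBasis : Module.Basis ℕ ℤ M₀ := Finsupp.basisSingleOne

theorem bBasis_apply (i : ℕ) : bBasis i = b i := by simp [bBasis, b]

theorem bBasis_coord_b (n i : ℕ) : bBasis.coord n (b i) = if i = n then 1 else 0 := by
  rw [← bBasis_apply, Module.Basis.coord_apply, bBasis.repr_self, Finsupp.single_apply]

theorem linearMap_ext_b {N : Type*} [AddCommGroup N] {f g : M₀ →ₗ[ℤ] N}
    (hfg : ∀ i, f (b i) = g (b i)) : f = g :=
  bBasis.ext fun i => by rw [bBasis_apply, hfg]

/-- The linear form `bᵢ ↦ h_{i-l}`, a row of the Jacobi–Trudi matrix. -/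
def hRow (e : ℕ → R) (l : ℕ) : M₀ →ₗ[ℤ] R :=
  Finsupp.linearCombination ℤ fun i : ℕ => h e (i - l)

theorem hRow_b (e : ℕ → R) (l i : ℕ) : hRow e l (b i) = h e (i - l) := by
  simp [hRow, b]

/-- The linear map `b_{i₀} ∧ ⋯ ∧ b_{i_{r-1}} ↦ det (h_{i_k - l})`; it is inverse to `φ_r` on the
`r`-th exterior power. -/
def hForm (e : ℕ → R) : Ext →ₗ[ℤ] R := detForm (hRow e)

theorem hForm_one (e : ℕ → R) : hForm e 1 = 1 := by
  rw [← ExteriorAlgebra.ιMulti_zero_apply (R := ℤ) (M := M₀) 0, hForm, detForm_ιMulti,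
    Matrix.det_fin_zero]

theorem map_hForm (f : R →+* S) {e : ℕ → R} (he : e 0 = 1) (x : Ext) :
    f (hForm e x) = hForm (fun n => f (e n)) x := by
  have hrow : (fun l => f.toIntAlgHom.toLinearMap ∘ₗ hRow e l) = hRow fun n => f (e n) :=
    funext fun l => linearMap_ext_b fun i => by
      rw [LinearMap.comp_apply, hRow_b, hRow_b]
      exact map_h f he _
  rw [hForm, hForm, ← hrow, ← map_detForm]
  rfl

theorem hRow_eSigma {e : ℕ → R} (he : e 0 = 1) (l : ℕ) (m : M₀) :
    hRow (eSigma e) l m = algebraMap R (Polynomial R) (hRow e l m) +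
      Polynomial.X * hRow (eSigma e) (l + 1) m := by
  have : hRow (eSigma e) l = (IsScalarTower.toAlgHom ℤ R (Polynomial R)).toLinearMap ∘ₗ hRow e l +
      LinearMap.mulLeft ℤ Polynomial.X ∘ₗ hRow (eSigma e) (l + 1) :=
    linearMap_ext_b fun i => by
      simp only [LinearMap.add_apply, LinearMap.comp_apply, LinearMap.mulLeft_apply, hRow_b,
        h_eSigma he (i - l), Nat.cast_succ, sub_sub]
      rfl
  exact LinearMap.congr_fun this m

theorem hRow_eSigmaBar {e : ℕ → R} (he : e 0 = 1) (l : ℕ) (m : M₀) :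
    hRow (eSigmaBar e) l m = algebraMap R (Polynomial R) (hRow e l m) -
      Polynomial.X * algebraMap R (Polynomial R) (hRow e (l + 1) m) := by
  let C : R →ₗ[ℤ] Polynomial R := (IsScalarTower.toAlgHom ℤ R (Polynomial R)).toLinearMap
  have : hRow (eSigmaBar e) l = C ∘ₗ hRow e l -
      LinearMap.mulLeft ℤ Polynomial.X ∘ₗ C ∘ₗ hRow e (l + 1) :=
    linearMap_ext_b fun i => by
      simp only [LinearMap.sub_apply, LinearMap.comp_apply, LinearMap.mulLeft_apply, hRow_b,
        h_eSigmaBar he, Nat.cast_succ, sub_sub]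
      rfl
  exact LinearMap.congr_fun this m

theorem coeffMul_h_eSigma {e : ℕ → R} (he : e 0 = 1) (i n r : ℕ) :
    coeffMul (seriesE e) (r - n) (h (eSigma e) (i - r)) = (if i = n then 1 else 0) -
      ∑ l ∈ Finset.range r, (seriesE e : LaurentSeries R).coeff (l - n) * h e (i - l) := by
  induction r with
  | zero =>
    have hprod := laurentSeries_coeff_mul_eq_sum (F := (seriesH e : LaurentSeries R))
      (G := seriesE e) (a := n) (s := Finset.range (i + 1)) (i - n)
      (fun k hk => by rw [PowerSeries.coeff_coe, if_pos (by omega)])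
      (fun j hj => by
        rw [Finset.mem_range] at hj
        rw [PowerSeries.coeff_coe, if_pos (by omega)])
    rw [← PowerSeries.coe_mul, mul_comm, seriesE_mul_seriesH he, PowerSeries.coe_one,
      HahnSeries.coeff_one] at hprod
    simp only [sub_eq_zero, Nat.cast_inj] at hprod
    rw [h_eSigma_eq_sum he, map_sum, Finset.sum_range_zero, sub_zero, hprod]
    refine Finset.sum_congr rfl fun j hj => ?_
    rw [Finset.mem_range] at hj
    rw [coeffMul_monomial, mul_comm, h_eq_coeff_seriesH]
    congr 2 <;> push_cast [Nat.le_of_lt_succ hj] <;> ring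
  | succ r ih =>
    rw [h_eSigma he, map_add, coeffMul_C, coeffMul_X_mul, ← eq_sub_iff_add_eq'] at ih
    rw [Finset.sum_range_succ, ← sub_sub, sub_right_comm, sub_right_comm,
      show ((r + 1 : ℕ) : ℤ) - n = r - n + 1 by push_cast; ring,
      show (i : ℤ) - (r + 1 : ℕ) = i - r - 1 by push_cast; ring, ih]

theorem coeffMul_hForm_eSigma {e : ℕ → R} (he : e 0 = 1) (n : ℕ) {r : ℕ} {x : Ext}
    (hx : x ∈ ⋀[ℤ]^(r + 1) M₀) :
    coeffMul (seriesE e) (r - n) (hForm (eSigma e) x) =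
      (-1) ^ r * hForm e (contract (bBasis.coord n) x) := by
  let a (l : ℕ) : R := (seriesE e : LaurentSeries R).coeff (l - n)
  refine map_detForm_eq_detForm_contract Polynomial.X (hRow_eSigma he) _ _ a (fun m => ?_) hx
  have : (coeffMul (seriesE e) (r - n)).restrictScalars ℤ ∘ₗ hRow (eSigma e) r =
      Algebra.linearMap ℤ R ∘ₗ bBasis.coord n - ∑ l ∈ Finset.range r, a l • hRow e l :=
    linearMap_ext_b fun i => by
      simp [hRow_b, coeffMul_h_eSigma he, bBasis_coord_b, a, -Module.Basis.coord_apply]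
  simpa using LinearMap.congr_fun this m

theorem coeffMul_hForm_eSigmaBar {e : ℕ → R} (he : e 0 = 1) (n : ℕ) {r : ℕ} {x : Ext}
    (hx : x ∈ ⋀[ℤ]^r M₀) :
    coeffMul (seriesH e) (n - r) (hForm (eSigmaBar e) x) =
      (-1) ^ r * hForm e (ExteriorAlgebra.ι ℤ (b n) * x) := by
  refine map_detForm_eq_detForm_ι_mul Polynomial.X (hRow_eSigmaBar he) _ _ (fun l hl => ?_) hx
  rw [coeffMul_X_pow, hRow_b, h_eq_coeff_seriesH]
  congr 1
  omega

theorem coeffMul_hForm_eSigmaBar_of_lt {e : ℕ → R} (he : e 0 = 1) {k : ℤ} {r : ℕ} (hk : k < -r)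
    {x : Ext} (hx : x ∈ ⋀[ℤ]^r M₀) : coeffMul (seriesH e) k (hForm (eSigmaBar e) x) = 0 := by
  have := map_detForm_eq_detForm_ι_mul Polynomial.X (hRow_eSigmaBar he) (coeffMul (seriesH e) k) 0
    (fun l hl => by
      rw [coeffMul_X_pow, map_zero, ← h_eq_coeff_seriesH, h_of_neg e (by omega)]) hx
  rwa [map_zero, zero_mul, map_zero, mul_zero] at this

end VertexOperators

section JacobiTrudi

variable {R : Type} [CommRing R]

theorem hForm_wedge (e : ℕ → R) (r : ℕ) (l : Part) : hForm e (wedge r l) = schur e r l := by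
  rw [wedge, exteriorPower.ιMulti_apply_coe, hForm, detForm_ιMulti, schur,
    ← Matrix.det_transpose, ← Matrix.det_submatrix_equiv_self Fin.revPerm]
  congr 1
  ext i j
  have hj : r - 1 - (r - (j + 1 : ℕ)) = j := by omega
  simp only [Matrix.submatrix_apply, Matrix.transpose_apply, Matrix.of_apply, hRow_b,
    Fin.revPerm_apply, Fin.val_rev, hj]
  congr 1
  omega

theorem part_apply_eq_zero_of_length_le (l : Part) {r : ℕ} (h : l.length ≤ r) : l.1 r = 0 := by
  by_contra h0
  have hsub : Finset.range (r + 1) ⊆ l.1.support := fun i hi => by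
    have := l.2 (Finset.mem_range_succ_iff.1 hi)
    rw [Finsupp.mem_support_iff]
    omega
  have := Finset.card_le_card hsub
  rw [Finset.card_range] at this
  exact absurd (this.trans h) (Nat.not_succ_le_self r)

theorem schur_succ {e : ℕ → R} (he : e 0 = 1) (l : Part) {r : ℕ} (h0 : l.1 r = 0) :
    schur e (r + 1) l = schur e r l := by
  rw [schur, Matrix.det_succ_column _ (Fin.last r), Fin.sum_univ_castSucc, Finset.sum_eq_zero,
    zero_add]
  · simp only [Fin.val_last, Matrix.of_apply, h0, ← two_mul, pow_mul]
    rw [Nat.cast_zero, zero_sub, neg_add_cancel, h_zero he, neg_one_sq, one_pow, one_mul, one_mul,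
      Fin.succAbove_last]
    rfl
  · intro i _
    simp only [Fin.val_last, Matrix.of_apply, h0, Fin.val_castSucc]
    rw [h_of_neg e (by omega), mul_zero, zero_mul]

theorem schur_eq_schur_length {e : ℕ → R} (he : e 0 = 1) (l : Part) {r : ℕ} (h : l.length ≤ r) :
    schur e r l = schur e l.length l := by
  induction r, h using Nat.le_induction with
  | base => rfl
  | succ r hr ih => rw [schur_succ he l (part_apply_eq_zero_of_length_le l hr), ih]

theorem val_le_of_strictMono {r : ℕ} {f : Fin r → ℕ} (hf : StrictMono f) (i : Fin r) :
    (i : ℕ) ≤ f i := by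
  obtain ⟨i, hi⟩ := i
  induction i with
  | zero => exact Nat.zero_le _
  | succ i ih => exact (ih (by omega)).trans_lt (hf (Fin.mk_lt_mk.2 i.lt_succ_self))

theorem exists_wedge_eq {r : ℕ} {f : Fin r → ℕ} (hf : StrictMono f) :
    ∃ l : Part, l.length ≤ r ∧ wedge r l = exteriorPower.ιMulti ℤ r fun i => b (f i) := by
  let part (j : ℕ) : ℕ := if hj : j < r then f ⟨r - 1 - j, by omega⟩ - (r - 1 - j) else 0
  let l : ℕ →₀ ℕ := Finsupp.onFinset (Finset.range r) part fun j hj => by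
    by_contra hjr
    exact hj (dif_neg (by simpa using hjr))
  have hl : Antitone l := antitone_nat_of_succ_le fun j => by
    change part (j + 1) ≤ part j
    by_cases hj : j + 1 < r
    · have : f ⟨r - 1 - (j + 1), by omega⟩ < f ⟨r - 1 - j, by omega⟩ :=
        hf (Fin.mk_lt_mk.2 (by omega))
      simp only [part, dif_pos hj, dif_pos (Nat.lt_of_succ_lt hj)]
      omega
    · simp only [part, dif_neg hj, Nat.zero_le]
  refine ⟨⟨l, hl⟩, ?_, ?_⟩
  · exact (Finset.card_le_card (Finsupp.support_onFinset_subset : l.support ⊆ _)).trans_eq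
      (Finset.card_range r)
  · have hpart (i : Fin r) : i + part (r - 1 - i) = f i := by
      have hi : r - 1 - (r - 1 - (i : ℕ)) = i := by omega
      have hlt : r - 1 - (i : ℕ) < r := by omega
      simp only [part, dif_pos hlt, hi, Fin.eta]
      exact Nat.add_sub_cancel' (val_le_of_strictMono hf i)
    exact congrArg _ (funext fun i => congrArg b (hpart i))

theorem wedgeSum_surjective (r : ℕ) : Function.Surjective (wedgeSum r) := by
  rw [← LinearMap.range_eq_top, eq_top_iff, ← (bBasis.exteriorPower r).span_eq,
    Submodule.span_le]
  rintro _ ⟨s, rfl⟩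
  obtain ⟨l, hl, hwedge⟩ := exists_wedge_eq (Set.powersetCard.ofFinEmbEquiv.symm s).strictMono
  refine ⟨Finsupp.single ⟨l, hl⟩ 1, ?_⟩
  rw [wedgeSum, Finsupp.linearCombination_single, one_smul, hwedge, exteriorPower.basis_apply,
    exteriorPower.ιMulti_family]
  simp only [Function.comp_def, bBasis_apply]

theorem hForm_wedgeSum (e : ℕ → R) {r : ℕ} (a : PartLE r →₀ ℤ) :
    hForm e (wedgeSum r a) = a.sum fun l c => c • schur e r l.1 := by
  simp [wedgeSum, Finsupp.linearCombination_apply, Finsupp.sum, hForm_wedge, -zsmul_eq_mul]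

theorem toBInf_eq (r : ℕ) (m : ⋀[ℤ]^r M₀) : toBInf r m = hForm eInf m := by
  conv_rhs => rw [← Function.rightInverse_invFun (wedgeSum_surjective r) m]
  rw [toBInf, hForm_wedgeSum, schurSumInf, Finsupp.linearCombination_apply,
    Finsupp.sum_mapDomain_index (by simp) (by simp [add_smul, -zsmul_eq_mul])]
  exact Finsupp.sum_congr fun l _ =>
    congrArg _ (schur_eq_schur_length (e := eInf) rfl l.1 l.2).symm

theorem hForm_mem_range_schurSumInf {r : ℕ} {x : Ext} (hx : x ∈ ⋀[ℤ]^r M₀) :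
    hForm eInf x ∈ LinearMap.range schurSumInf := by
  rw [← toBInf_eq r ⟨x, hx⟩]
  exact ⟨_, rfl⟩

end JacobiTrudi

section SchubertDerivations

variable {R : Type} [CommRing R]

/-- The linear map `⋀ M₀ → R` applied to all coefficients of a polynomial. -/
def polyMap (L : Ext →ₗ[ℤ] R) : Polynomial Ext →ₗ[ℤ] Polynomial R :=
  Polynomial.lsum fun k => (Polynomial.monomial k).restrictScalars ℤ ∘ₗ L

theorem polyMap_monomial (L : Ext →ₗ[ℤ] R) (k : ℕ) (x : Ext) :
    polyMap L (Polynomial.monomial k x) = Polynomial.monomial k (L x) := by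
  simp [polyMap, Polynomial.sum_monomial_index]

theorem coeff_polyMap (L : Ext →ₗ[ℤ] R) (P : Polynomial Ext) (k : ℕ) :
    (polyMap L P).coeff k = L (P.coeff k) := by
  induction P using Polynomial.induction_on' with
  | add P Q hP hQ => rw [map_add, Polynomial.coeff_add, hP, hQ, Polynomial.coeff_add, map_add]
  | monomial j x =>
    rw [polyMap_monomial, Polynomial.coeff_monomial, Polynomial.coeff_monomial]
    split_ifs
    · rfl
    · rw [map_zero]

/-- The linear form `M₀ → R` applied to all coefficients of an element of `M₀[w]`. -/
def polyRow (g : M₀ →ₗ[ℤ] R) : (ℕ →₀ M₀) →ₗ[ℤ] Polynomial R :=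
  Finsupp.lsum ℤ fun j => (Polynomial.monomial j).restrictScalars ℤ ∘ₗ g

theorem polyRow_single (g : M₀ →ₗ[ℤ] R) (j : ℕ) (m : M₀) :
    polyRow g (Finsupp.single j m) = Polynomial.monomial j (g m) := by
  simp [polyRow]

theorem prod_ofFn_monomial {A : Type*} [Semiring A] {r : ℕ} (j : Fin r → ℕ) (x : Fin r → A) :
    (List.ofFn fun i => Polynomial.monomial (j i) (x i)).prod =
      Polynomial.monomial (∑ i, j i) (List.ofFn x).prod := by
  induction r with
  | zero => simp
  | succ r ih =>
    rw [List.ofFn_succ, List.prod_cons, ih, Polynomial.monomial_mul_monomial, Fin.sum_univ_succ,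
      List.ofFn_succ, List.prod_cons]

theorem det_monomial {r : ℕ} (j : Fin r → ℕ) (A : Matrix (Fin r) (Fin r) R) :
    (Matrix.of fun k l => Polynomial.monomial (j k) (A k l)).det =
      Polynomial.monomial (∑ k, j k) A.det := by
  have hrows : (Matrix.of fun k l => Polynomial.monomial (j k) (A k l)) =
      Matrix.of fun k l => Polynomial.X ^ j k * Polynomial.C.mapMatrix A k l := by
    ext1 k l
    exact Polynomial.C_mul_X_pow_eq_monomial.symm.trans (mul_comm _ _)
  rw [hrows, Matrix.det_mul_column, Finset.prod_pow_eq_pow_sum, ← RingHom.map_det, mul_comm,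
    Polynomial.C_mul_X_pow_eq_monomial]

theorem polyMap_detForm_prod (g : ℕ → M₀ →ₗ[ℤ] R) {r : ℕ} (q : Fin r → ℕ →₀ M₀) :
    polyMap (detForm g) (List.ofFn fun i => toExtPoly (q i)).prod =
      (Matrix.of fun k l : Fin r => polyRow (g l) (q k)).det := by
  have hmulti : (polyMap (detForm g)).compMultilinearMap
      ((MultilinearMap.mkPiAlgebraFin ℤ r (Polynomial Ext)).compLinearMap fun _ => toExtPoly) =
      ((Matrix.detRowAlternating (n := Fin r) (R := Polynomial R)).toMultilinearMap.restrictScalars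
        ℤ).compLinearMap fun _ => LinearMap.pi fun l : Fin r => polyRow (g l) := by
    refine Module.Basis.ext_multilinear (fun _ => Finsupp.basis fun _ => bBasis) fun v => ?_
    have hv (i : Fin r) : (Finsupp.basis fun _ : ℕ => bBasis) (v i) =
        Finsupp.single (v i).1 (b (v i).2) := by simp [bBasis_apply]
    simp only [hv, LinearMap.compMultilinearMap_apply, MultilinearMap.compLinearMap_apply,
      MultilinearMap.mkPiAlgebraFin_apply, toExtPoly_single]
    rw [prod_ofFn_monomial, ← ExteriorAlgebra.ιMulti_apply, polyMap_monomial, detForm_ιMulti,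
      ← det_monomial]
    exact congrArg Matrix.det (Matrix.ext fun k l => (polyRow_single _ _ _).symm)
  exact congrArg (fun F => F q) hmulti

theorem polyMap_hasseSchmidt (g : ℕ → M₀ →ₗ[ℤ] R) (f : M₀ →ₗ[ℤ] (ℕ →₀ M₀)) {r : ℕ} {x : Ext}
    (hx : x ∈ ⋀[ℤ]^r M₀) :
    polyMap (detForm g) (hasseSchmidt f x) = detForm (fun l => polyRow (g l) ∘ₗ f) x := by
  refine eq_of_forall_ιMulti (L := polyMap (detForm g) ∘ₗ (hasseSchmidt f).toLinearMap)
    (fun m => ?_) hx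
  rw [detForm_ιMulti, LinearMap.comp_apply, AlgHom.toLinearMap_apply, ExteriorAlgebra.ιMulti_apply,
    map_list_prod, List.map_ofFn]
  have hfactor : hasseSchmidt f ∘ (fun i => ExteriorAlgebra.ι ℤ (m i)) =
      fun i => toExtPoly (f (m i)) := by
    ext1 i
    simp [hasseSchmidt]
  rw [hfactor, polyMap_detForm_prod]
  rfl

theorem polyRow_comp_shiftMinus {e : ℕ → R} (he : e 0 = 1) (l : ℕ) :
    polyRow (hRow e l) ∘ₗ shiftMinus = hRow (eSigma e) l := by
  refine linearMap_ext_b fun i => ?_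
  rw [hRow_b, h_eSigma_eq_sum he, LinearMap.comp_apply, shiftMinus, b,
    Finsupp.linearCombination_single, one_smul, map_sum]
  simp only [polyRow_single, hRow_b]

theorem polyRow_comp_shiftBarMinus {e : ℕ → R} (he : e 0 = 1) (l : ℕ) :
    polyRow (hRow e l) ∘ₗ shiftBarMinus = hRow (eSigmaBar e) l := by
  refine linearMap_ext_b fun i => ?_
  rw [hRow_b, h_eSigmaBar he, LinearMap.comp_apply, shiftBarMinus, b,
    Finsupp.linearCombination_single, one_smul, map_sub, polyRow_single, hRow_b,
    Polynomial.monomial_zero_left]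
  congr 1
  split_ifs with hi
  · rw [map_zero, h_of_neg e (by omega), map_zero, mul_zero]
  · rw [polyRow_single, hRow_b, mul_comm, Polynomial.C_mul_X_eq_monomial,
      Nat.cast_pred (Nat.pos_of_ne_zero hi), sub_right_comm]

theorem polyMap_sigmaMinus {e : ℕ → R} (he : e 0 = 1) {r : ℕ} {x : Ext} (hx : x ∈ ⋀[ℤ]^r M₀) :
    polyMap (hForm e) (sigmaMinus x) = hForm (eSigma e) x := by
  rw [sigmaMinus, hForm, polyMap_hasseSchmidt _ _ hx]
  exact congrArg (fun g => detForm g x) (funext (polyRow_comp_shiftMinus he))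

theorem polyMap_sigmaBarMinus {e : ℕ → R} (he : e 0 = 1) {r : ℕ} {x : Ext}
    (hx : x ∈ ⋀[ℤ]^r M₀) : polyMap (hForm e) (sigmaBarMinus x) = hForm (eSigmaBar e) x := by
  rw [sigmaBarMinus, hForm, polyMap_hasseSchmidt _ _ hx]
  exact congrArg (fun g => detForm g x) (funext (polyRow_comp_shiftBarMinus he))

end SchubertDerivations

section Injectivity

variable {R : Type} [CommRing R]

/-- The homomorphism from `B_∞` that sends `e_n` to `a n` for `n ≥ 1`. -/
def specialize (a : ℕ → R) : BInf →ₐ[ℤ] R := MvPolynomial.aeval fun n => a (n + 1)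

theorem specialize_eInf {a : ℕ → R} (ha : a 0 = 1) (n : ℕ) : specialize a (eInf n) = a n := by
  cases n with
  | zero => rw [eInf, map_one, ha]
  | succ n => simp [eInf, specialize]

theorem specialize_hForm {a : ℕ → R} (ha : a 0 = 1) (x : Ext) :
    specialize a (hForm eInf x) = hForm a x :=
  (map_hForm (specialize a).toRingHom (e := eInf) rfl x).trans
    (congrArg (fun e => hForm e x) (funext (specialize_eInf ha)))

theorem e_zero (r : ℕ) : e r 0 = 1 := rfl

theorem e_of_lt {r n : ℕ} (hn : r < n) : e r n = 0 := by
  obtain ⟨n, rfl⟩ := Nat.exists_eq_succ_of_ne_zero (Nat.ne_zero_of_lt hn)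
  exact dif_neg (by omega)

theorem exists_algHom_e_eq {r : ℕ} {a : ℕ → R} (ha : a 0 = 1) (har : ∀ n, r < n → a n = 0) :
    ∃ f : B r →ₐ[ℤ] R, ∀ n, f (e r n) = a n := by
  refine ⟨MvPolynomial.aeval fun n : Fin r => a (n + 1), fun n => ?_⟩
  rcases lt_or_ge r n with hn | hn
  · rw [e_of_lt hn, map_zero, har n hn]
  · cases n with
    | zero => rw [e_zero, map_one, ha]
    | succ n => simp [e, Nat.lt_of_succ_le hn]

theorem hForm_eq_zero_of_hForm_e_eq_zero {r : ℕ} {a : ℕ → R} (ha : a 0 = 1)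
    (har : ∀ n, r < n → a n = 0) {x : Ext} (hx : hForm (e r) x = 0) : hForm a x = 0 := by
  obtain ⟨f, hf⟩ := exists_algHom_e_eq ha har
  have := map_hForm (f : B r →+* R) (e_zero r) x
  rw [hx, map_zero] at this
  rw [this]
  exact congrArg (fun e => hForm e x) (funext fun n => (hf n).symm)

theorem hForm_e_contract_eq_zero {r : ℕ} {x : Ext} (hx : x ∈ ⋀[ℤ]^(r + 1) M₀)
    (h0 : hForm (e (r + 1)) x = 0) (n : ℕ) : hForm (e r) (contract (bBasis.coord n) x) = 0 := by
  have hSigma : hForm (eSigma (e r)) x = 0 := by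
    refine hForm_eq_zero_of_hForm_e_eq_zero (eSigma_zero (e_zero r)) (fun k hk => ?_) h0
    obtain ⟨k, rfl⟩ := Nat.exists_eq_succ_of_ne_zero (Nat.ne_zero_of_lt hk)
    rw [eSigma, e_of_lt (by omega), e_of_lt (by omega), map_zero, mul_zero, add_zero]
  have := coeffMul_hForm_eSigma (e_zero r) n hx
  rw [hSigma, map_zero] at this
  exact (isUnit_one.neg.pow r).mul_right_eq_zero.1 this.symm

theorem eq_zero_of_hForm_e_eq_zero {r : ℕ} {x : Ext} (hx : x ∈ ⋀[ℤ]^r M₀)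
    (h0 : hForm (e r) x = 0) : x = 0 := by
  induction r generalizing x with
  | zero =>
    rw [ExteriorAlgebra.exteriorPower, pow_zero] at hx
    obtain ⟨c, rfl⟩ := Submodule.mem_one.1 hx
    rw [Algebra.algebraMap_eq_smul_one, map_smul, hForm_one, ← Algebra.algebraMap_eq_smul_one] at h0
    rw [(FaithfulSMul.algebraMap_eq_zero_iff ℤ (B 0)).1 h0, map_zero]
  | succ r ih =>
    exact eq_zero_of_contract_eq_zero bBasis hx fun n =>
      ih (contract_mem hx _) (hForm_e_contract_eq_zero hx h0 n)

theorem eq_zero_of_hForm_eInf_eq_zero {r : ℕ} {x : Ext} (hx : x ∈ ⋀[ℤ]^r M₀)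
    (h0 : hForm eInf x = 0) : x = 0 :=
  eq_zero_of_hForm_e_eq_zero hx <| by rw [← specialize_hForm (e_zero r), h0, map_zero]

end Injectivity

section Surjectivity

theorem hForm_wedge_eInf {r : ℕ} (l : Part) (h : l.length ≤ r) :
    hForm eInf (wedge r l) = schurInf l := by
  rw [hForm_wedge, schurInf, schur_eq_schur_length rfl l h]

theorem eval₂_specialize_eSigma_eSigmaBar (p : BInf) :
    Polynomial.eval₂ (specialize (eSigma eInf) : BInf →+* Polynomial BInf) Polynomial.X
      (specialize (eSigmaBar eInf) p) = Polynomial.C p := by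
  have hgen (n : ℕ) : Polynomial.eval₂ (specialize (eSigma eInf) : BInf →+* Polynomial BInf)
      Polynomial.X (eSigmaBar eInf n) = Polynomial.C (eInf n) := by
    induction n with
    | zero => simp [eSigmaBar, eInf]
    | succ n ih =>
      rw [eSigmaBar, Polynomial.eval₂_sub, Polynomial.eval₂_X_mul, ih, Polynomial.eval₂_C,
        RingHom.coe_coe, specialize_eInf (eSigma_zero rfl), eSigma, mul_comm, add_sub_cancel_right]
  have hcomp : (Polynomial.eval₂RingHom (specialize (eSigma eInf) : BInf →+* Polynomial BInf)
      Polynomial.X).comp (specialize (eSigmaBar eInf) : BInf →+* Polynomial BInf) =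
        Polynomial.C := by
    refine MvPolynomial.ringHom_ext' (RingHom.ext_int _ _) fun n => ?_
    refine Eq.trans ?_ (hgen (n + 1))
    exact congrArg _ (specialize_eInf (eSigmaBar_zero rfl) (n + 1))
  exact DFunLike.congr_fun hcomp p

theorem neg_one_pow_mul_mem_iff {R : Type*} [Ring R] (W : Submodule ℤ R) (n : ℕ) {x : R} :
    (-1) ^ n * x ∈ W ↔ x ∈ W := by
  rcases neg_one_pow_eq_or R n with hn | hn <;> simp [hn]

theorem coeffMul_specialize_eSigma_mem {k r : ℕ} (hk : k ≤ r) {x : Ext}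
    (hx : x ∈ ⋀[ℤ]^(r + 1) M₀) :
    coeffMul (seriesE eInf) k (specialize (eSigma eInf) (hForm eInf x)) ∈
      LinearMap.range schurSumInf := by
  have hc := coeffMul_hForm_eSigma (e := eInf) rfl (r - k) hx
  rw [show (r : ℤ) - (r - k : ℕ) = k by omega] at hc
  rw [specialize_hForm (eSigma_zero rfl), hc, neg_one_pow_mul_mem_iff]
  exact hForm_mem_range_schurSumInf (contract_mem hx _)

theorem coeff_specialize_eSigmaBar {r : ℕ} {x : Ext} (hx : x ∈ ⋀[ℤ]^r M₀) (j : ℕ) :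
    (specialize (eSigmaBar eInf) (hForm eInf x)).coeff j =
      hForm eInf ((sigmaBarMinus x).coeff j) := by
  rw [specialize_hForm (eSigmaBar_zero rfl), ← polyMap_sigmaBarMinus rfl hx, coeff_polyMap]

-- Up to sign `e_k p` is the coefficient of `zᵏ` in `E(z) p = E(z) σ₋(z) (σ̄₋(z) p)`, and the
-- coefficients of `E(z) σ₋(z)` are contractions.
theorem eInf_mul_schurInf_mem (k : ℕ) (l : Part) :
    eInf k * schurInf l ∈ LinearMap.range schurSumInf := by
  let P := specialize (eSigmaBar eInf) (schurInf l)
  let r := l.length + k + P.natDegree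
  have hwedge : hForm eInf (wedge (r + 1) l) = schurInf l := hForm_wedge_eInf l (by omega)
  have hmul : (-1) ^ k * (eInf k * schurInf l) =
      ∑ j ∈ Finset.range (P.natDegree + 1),
        coeffMul (seriesE eInf) (k + j : ℕ) (specialize (eSigma eInf) (P.coeff j)) := by
    have := congrArg (coeffMul (seriesE eInf) k) (eval₂_specialize_eSigma_eSigmaBar (schurInf l))
    rw [coeffMul_C, Polynomial.eval₂_eq_sum_range, map_sum] at this
    rw [← mul_assoc]
    simpa [seriesE, P, mul_comm _ (Polynomial.X ^ _), coeffMul_X_pow_mul] using this.symm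
  rw [← neg_one_pow_mul_mem_iff _ k, hmul]
  refine Submodule.sum_mem _ fun j hj => ?_
  have hj' := Finset.mem_range_succ_iff.1 hj
  have hcoeff := coeff_specialize_eSigmaBar (wedge (r + 1) l).2 j
  rw [hwedge] at hcoeff
  rw [hcoeff]
  exact coeffMul_specialize_eSigma_mem (by omega)
    (hasseSchmidt_coeff_mem shiftBarMinus (r + 1) _ (wedge (r + 1) l).2 j)

theorem eInf_mul_mem_range (k : ℕ) {p : BInf} (hp : p ∈ LinearMap.range schurSumInf) :
    eInf k * p ∈ LinearMap.range schurSumInf := by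
  obtain ⟨a, rfl⟩ := hp
  rw [schurSumInf, Finsupp.linearCombination_apply, Finsupp.sum, Finset.mul_sum]
  refine Submodule.sum_mem _ fun l _ => ?_
  rw [mul_smul_comm]
  exact Submodule.smul_mem _ _ (eInf_mul_schurInf_mem k l)

theorem schurSumInf_surjective : Function.Surjective schurSumInf := by
  intro p
  induction p using MvPolynomial.induction_on with
  | C c =>
    have h1 : (1 : Ext) ∈ ⋀[ℤ]^0 M₀ := by
      rw [ExteriorAlgebra.exteriorPower, pow_zero]
      exact Submodule.one_le.1 le_rfl
    have := Submodule.smul_mem _ c (hForm_mem_range_schurSumInf h1)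
    rwa [hForm_one, MvPolynomial.smul_eq_C_mul, mul_one] at this
  | add p q hp hq => exact Submodule.add_mem (LinearMap.range schurSumInf) hp hq
  | mul_X p n hp =>
    rw [mul_comm]
    exact eInf_mul_mem_range (n + 1) hp

theorem exists_hForm_eq (p : BInf) :
    ∃ s₀, ∀ s ≥ s₀, ∃ x : ⋀[ℤ]^s M₀, hForm eInf x = p := by
  obtain ⟨a, rfl⟩ := schurSumInf_surjective p
  refine ⟨a.support.sup Part.length, fun s hs => ⟨a.sum fun l c => c • wedge s l, ?_⟩⟩
  rw [schurSumInf, Finsupp.linearCombination_apply, Finsupp.sum, Finsupp.sum,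
    Submodule.coe_sum, map_sum]
  refine Finset.sum_congr rfl fun l hl => ?_
  rw [Submodule.coe_smul, map_smul, hForm_wedge_eInf l ((Finset.le_sup hl).trans hs)]

end Surjectivity

section OperatorsOnBInf

theorem onBInf_eq {f : M₀ →ₗ[ℤ] (ℕ →₀ M₀)} {S : BInf →ₐ[ℤ] Polynomial BInf}
    (h : ∀ (r : ℕ) (x : Ext), x ∈ ⋀[ℤ]^r M₀ →
      polyMap (hForm eInf) (hasseSchmidt f x) = S (hForm eInf x)) (p : BInf) :
    onBInf f p = S p := by
  conv_rhs => rw [← Function.rightInverse_invFun schurSumInf_surjective p]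
  rw [onBInf, schurSumInf, Finsupp.linearCombination_apply, map_finsuppSum]
  refine Finsupp.sum_congr fun l _ => ?_
  rw [map_zsmul, ← hForm_wedge_eInf l le_rfl, ← h _ _ (wedge _ l).2]
  simp only [toBInf_eq, hsCoeff]
  rfl

theorem sigmaMinusB_eq (p : BInf) : sigmaMinusB p = specialize (eSigma eInf) p :=
  onBInf_eq (fun _ _ hx => (polyMap_sigmaMinus rfl hx).trans
    (specialize_hForm (eSigma_zero rfl) _).symm) p

theorem sigmaBarMinusB_eq (p : BInf) : sigmaBarMinusB p = specialize (eSigmaBar eInf) p :=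
  onBInf_eq (fun _ _ hx => (polyMap_sigmaBarMinus rfl hx).trans
    (specialize_hForm (eSigmaBar_zero rfl) _).symm) p

end OperatorsOnBInf

section Residue

theorem coeff_mul_toLaurent (F : LaurentSeries BInf) (P : Polynomial BInf) (k : ℤ) :
    (F * toLaurent P).coeff k = coeffMul F k P := by
  induction P using Polynomial.induction_on' with
  | add P Q hP hQ => rw [map_add, mul_add, HahnSeries.coeff_add, hP, hQ, map_add]
  | monomial j c =>
    have hmono : toLaurent (Polynomial.monomial j c) = HahnSeries.single (-(j : ℤ)) c := by
      rw [toLaurent, Polynomial.aeval_monomial, HahnSeries.single_pow, HahnSeries.algebraMap_apply',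
        PowerSeries.algebraMap_apply, HahnSeries.ofPowerSeries_C]
      simp [HahnSeries.C_apply, HahnSeries.single_mul_single]
    rw [hmono, coeffMul_monomial, HahnSeries.coeff_mul_single, sub_neg_eq_add]

theorem coeff_gammaStar {r : ℕ} {x : Ext} (hx : x ∈ ⋀[ℤ]^(r + 1) M₀) (n : ℕ) :
    (gammaStar (hForm eInf x)).coeff (r - n) =
      (-1) ^ r * hForm eInf (contract (bBasis.coord n) x) := by
  rw [gammaStar, coeff_mul_toLaurent, sigmaMinusB_eq, specialize_hForm (eSigma_zero rfl),
    coeffMul_hForm_eSigma rfl n hx]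

theorem coeff_gamma {r : ℕ} {x : Ext} (hx : x ∈ ⋀[ℤ]^r M₀) (n : ℕ) :
    (gamma (hForm eInf x)).coeff (n - r) =
      (-1) ^ r * hForm eInf (ExteriorAlgebra.ι ℤ (b n) * x) := by
  rw [gamma, coeff_mul_toLaurent, sigmaBarMinusB_eq, specialize_hForm (eSigmaBar_zero rfl),
    coeffMul_hForm_eSigmaBar rfl n hx]

theorem coeff_gamma_of_lt {r : ℕ} {x : Ext} (hx : x ∈ ⋀[ℤ]^r M₀) {k : ℤ} (hk : k < -r) :
    (gamma (hForm eInf x)).coeff k = 0 := by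
  rw [gamma, coeff_mul_toLaurent, sigmaBarMinusB_eq, specialize_hForm (eSigmaBar_zero rfl),
    coeffMul_hForm_eSigmaBar_of_lt rfl hk hx]

theorem residue_eq {r : ℕ} {x : Ext} (hx : x ∈ ⋀[ℤ]^(r + 1) M₀) :
    residue (tensorSeries (gammaStar (hForm eInf x)) (gamma (hForm eInf x))) =
      -TensorProduct.map (hForm eInf) (hForm eInf) (plucker x) := by
  obtain ⟨s, hs, hplucker⟩ := exists_plucker_eq_sum bBasis x
  have hindex (n : ℕ) : (-1 : ℤ) + (r + 1 : ℕ) - n = r - n := by omega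
  rw [residue, tensorSeries, laurentSeries_coeff_mul_eq_sum (a := (r + 1 : ℕ)) (s := s), hplucker,
    map_sum, ← Finset.sum_neg_distrib]
  · refine Finset.sum_congr rfl fun n _ => ?_
    rw [HahnSeries.map_coeff, HahnSeries.map_coeff, hindex, coeff_gammaStar hx, coeff_gamma hx,
      bBasis_apply, TensorProduct.map_tmul]
    refine (Algebra.TensorProduct.tmul_mul_tmul _ _ _ _).trans ?_
    rcases neg_one_pow_eq_or BInf r with h | h <;>
      simp [h, pow_succ, TensorProduct.tmul_neg, TensorProduct.neg_tmul]
  · intro k hk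
    rw [HahnSeries.map_coeff, coeff_gamma_of_lt hx hk, map_zero]
  · intro n hn
    rw [HahnSeries.map_coeff, hindex, coeff_gammaStar hx, hs n hn, map_zero, mul_zero, map_zero]

theorem ι_mul_mem {r : ℕ} {x : Ext} (hx : x ∈ ⋀[ℤ]^r M₀) (v : M₀) :
    ExteriorAlgebra.ι ℤ v * x ∈ ⋀[ℤ]^(r + 1) M₀ := by
  rw [ExteriorAlgebra.exteriorPower, pow_succ']
  exact Submodule.mul_mem_mul ⟨v, rfl⟩ hx

theorem map_hForm_plucker_eq_zero_iff {r : ℕ} {x : Ext} (hx : x ∈ ⋀[ℤ]^(r + 1) M₀) :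
    TensorProduct.map (hForm eInf) (hForm eInf) (plucker x) = 0 ↔ plucker x = 0 := by
  refine ⟨fun h0 => ?_, fun h0 => by rw [h0, map_zero]⟩
  obtain ⟨s, -, hplucker⟩ := exists_plucker_eq_sum bBasis x
  let u : ⋀[ℤ]^r M₀ ⊗[ℤ] ⋀[ℤ]^(r + 2) M₀ := ∑ i ∈ s,
    ⟨contract (bBasis.coord i) x, contract_mem hx _⟩ ⊗ₜ[ℤ]
      ⟨ExteriorAlgebra.ι ℤ (bBasis i) * x, ι_mul_mem hx _⟩
  have hu : TensorProduct.map (⋀[ℤ]^r M₀).subtype (⋀[ℤ]^(r + 2) M₀).subtype u = plucker x := by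
    rw [hplucker, map_sum]
    rfl
  have hinj (k : ℕ) : Function.Injective (hForm eInf ∘ₗ (⋀[ℤ]^k M₀).subtype) :=
    (injective_iff_map_eq_zero _).2 fun y hy =>
      Subtype.ext (eq_zero_of_hForm_eInf_eq_zero y.2 hy)
  rw [← hu, ← LinearMap.comp_apply, ← TensorProduct.map_comp] at h0
  rw [← hu, (injective_iff_map_eq_zero _).1
    (TensorProduct.map_injective_of_flat_flat _ _ (hinj r) (hinj (r + 2))) u h0, map_zero]

theorem residue_eq_zero_iff {r : ℕ} (x : ⋀[ℤ]^(r + 1) M₀) :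
    residue (tensorSeries (gammaStar (hForm eInf x)) (gamma (hForm eInf x))) = 0 ↔
      x ∈ grassmannCone (r + 1) := by
  rw [residue_eq x.2, neg_eq_zero, map_hForm_plucker_eq_zero_iff x.2, mem_grassmannCone_iff]

end Residue

section Correspondence

theorem phi_hForm {s : ℕ} (x : ⋀[ℤ]^s M₀) : phi s (hForm (e s) x) = x := by
  have hschur (a) : schurSum s a = hForm (e s) (wedgeSum s a) := by
    rw [hForm_wedgeSum, schurSum, Finsupp.linearCombination_apply]
  obtain ⟨a, rfl⟩ := wedgeSum_surjective s x
  have hinv := Function.invFun_eq (f := schurSum s) ⟨a, hschur a⟩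
  rw [hschur] at hinv
  rw [phi, ← sub_eq_zero, Subtype.ext_iff]
  refine eq_zero_of_hForm_e_eq_zero (Subtype.property _) ?_
  rw [Submodule.coe_sub, map_sub, hinv, sub_self]

theorem specialize_e_inclB {s : ℕ} (q : B s) : specialize (e s) (inclB s q) = q := by
  have : (specialize (e s)).comp (inclB s) = AlgHom.id ℤ (B s) :=
    MvPolynomial.algHom_ext fun i =>
      show specialize (e s) (inclB s (MvPolynomial.X i)) = MvPolynomial.X i by
        simp [specialize, inclB, e]
  exact DFunLike.congr_fun this q

theorem phi_eq_of_hForm_eq_inclB {s : ℕ} {q : B s} {x : ⋀[ℤ]^s M₀}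
    (hx : hForm eInf x = inclB s q) : phi s q = x := by
  rw [← phi_hForm x, ← specialize_hForm (e_zero s), hx, specialize_e_inclB]

theorem exists_inclB_eq (p : BInf) : ∃ s₀, ∀ s ≥ s₀, ∃ q : B s, inclB s q = p := by
  refine ⟨p.vars.sup id + 1, fun s hs =>
    MvPolynomial.exists_rename_eq_of_vars_subset_range p Fin.val Fin.val_injective fun i hi => ?_⟩
  exact ⟨⟨i, (Nat.lt_succ_of_le (Finset.le_sup (f := id) hi)).trans_le hs⟩, rfl⟩

theorem exists_phi_mem_grassmannCone_iff (p : BInf) :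
    ∃ s₀, ∀ s ≥ s₀, (∃ q : B s, inclB s q = p ∧ phi s q ∈ grassmannCone s) ↔
      residue (tensorSeries (gammaStar p) (gamma p)) = 0 := by
  obtain ⟨s₁, hForm_eq⟩ := exists_hForm_eq p
  obtain ⟨s₂, inclB_eq⟩ := exists_inclB_eq p
  refine ⟨s₁ + s₂ + 1, fun s hs => ?_⟩
  obtain ⟨r, rfl⟩ := Nat.exists_eq_succ_of_ne_zero (show s ≠ 0 by omega)
  obtain ⟨x, hx⟩ := hForm_eq (r + 1) (by omega)
  rw [← hx, residue_eq_zero_iff]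
  constructor
  · rintro ⟨q, hq, hcone⟩
    rwa [phi_eq_of_hForm_eq_inclB hq.symm] at hcone
  · intro hcone
    obtain ⟨q, hq⟩ := inclB_eq (r + 1) (by omega)
    rw [← hx] at hq
    exact ⟨q, hq, by rwa [phi_eq_of_hForm_eq_inclB hq.symm]⟩

end Correspondence

end GrassmannKP

end

theorem mainTheorem4 (p : GrassmannKP.BInf) :
    GrassmannKP.CorrespondsToCone p ↔
      GrassmannKP.residue (GrassmannKP.tensorSeries (GrassmannKP.gammaStar p) (GrassmannKP.gamma p)) = 0 := by
  obtain ⟨s₀, hcone⟩ := GrassmannKP.exists_phi_mem_grassmannCone_iff p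
  constructor
  · rintro ⟨r, hr⟩
    exact (hcone (s₀ + r) (by omega)).1 (hr (s₀ + r) (by omega))
  · exact fun hres => ⟨s₀, fun s hs => (hcone s hs).2 hres⟩
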